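/- **Setting.** Let $C$ be a set of colors; equip $C^\omega$ with the $\sigma$-algebra generated by the cylinders $uC^\omega$ of finite words $u\in C^*$, and let $\mathcal D$ be the set of probability distributions on $C^\omega$. A *preference relation* is a total preorder $\sqsubseteq$ on $\mathcal D$. It is extended to sets by $\Lambda_1\sqsubseteq\Lambda_2$ iff for all $\mu_1\in\Lambda_1$ there is $\mu_2\in\Lambda_2$ with $\mu_1\sqsubseteq\mu_2$. For $w\in C^*$ and $\mu\in\mathcal D$, $w\mu$ is the law of $wx$ when $x$ has law $\mu$, and $w\Lambda=\{w\mu\mid\mu\in\Lambda\}$. *Mixing is useless* for $\sqsubseteq$ if for every countable $I$, all reals $\lambda_i>0$ ($i\in I$) with $\sum_i\lambda_i=1$ and all families with $\mu_i\sqsubseteq\mu_i'$ for all $i\in I$, we have $\sum_i\lambda_i\mu_i\sqsubseteq\sum_i\lambda_i\mu_i'$. A *memory skeleton* $\mathcal M=(M,m_{\rm init},\alpha)$ is a (possibly infinite) set $M$ with $m_{\rm init}\in M$ and an update function $\alpha:M\times C\to M$ such that for every finite $B\subseteq C$ only finitely many states are reachable from $m_{\rm init}$ with colors in $B$; $\hat\alpha:M\times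 C^*\to M$ is its extension to words, and $L_{m,m'}=\{w\in C^*\mid\hat\alpha(m,w)=m'\}$. An *arena* has a finite set of states, each controlled by player 1 or player 2, a finite set of actions, a nonempty set of available actions in each state, and for each state $s$ and available action $a$ a distribution $\delta(s,a)$ on states and a color. It is *deterministic* if all $\delta(s,a)$ have a one-point support. It is a *one-player arena of player 1* if every state of player 2 has exactly one available action. An *initialized arena* $(\mathcal A,S_{\rm init})$ is an arena with a nonempty set of initial states from which all its states are reachable; $(\mathcal A,s)$ stands for $(\mathcal A,\{s\})$. A history is a finite sequence $s_0a_1s_1\dots a_ns_n$ with $s_0\in S_{\rm init}$, $a_{j+1}$ available in $s_j$ and $\delta(s_j,a_{j+1})(s_{j+1})>0$. A strategy maps each history ending in a state of the player to a distribution on the actions available there. It is *pure* if these distributions are Dirac; *finite-memory* if it is encoded by a finite Mealy machine that reads the state-action pairs of the history and whose choice depends on its state and the current state; *based on $\mathcal M$* if its choice depends only on the current state and on $\hat\alpha(m_{\rm init},\cdot)$ applied to the word of colors of the history. Let $\mathsf X$ be one of four types of strategies: pure finite-memory ($\mathsf{PFM}$), pure ($\mathsf P$), randomized finite-memory, or general.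 Let $\mathsf Y\in\{\mathsf D,\mathsf S\}$; the class given by $\mathsf Y$ consists of the initialized one-player arenas of player 1 that are deterministic ($\mathsf D$), or of all of them ($\mathsf S$). A state $s$ and two strategies induce a distribution on plays and thereby one in $\mathcal D$, written $\mathsf{Pc}_{\mathcal A,s}(\sigma_1,\sigma_2)$. A strategy $\sigma_1$ of player 1 is *$\mathsf X$-optimal* in $(\mathcal A,S_{\rm init})$ if it is of type $\mathsf X$ and, for every strategy $\sigma_1'$ of player 1 of type $\mathsf X$ and every $s\in S_{\rm init}$, $U_s(\sigma_1)\subseteq U_s(\sigma_1')$, where $U_s(\sigma)=\{\mu\mid\exists\,\sigma_2\text{ of type }\mathsf X:\ \mathsf{Pc}_{\mathcal A,s}(\sigma,\sigma_2)\sqsubseteq\mu\}$. For a one-player arena, $\mathrm{Cols}(\mathcal A,s)\subseteq\mathcal D$ is the set of distributions induced from $s$ by the strategies of type $\mathsf X$ of player 1. The *merge* $(\mathcal A_1,s_1)\sqcup(\mathcal A_2,s_2)$ is the disjoint union (of states and of actions) of the two arenas in which $s_1$ and $s_2$ are replaced by one state $t$ of player 1, whose available actions are those of $s_1$ and those of $s_2$,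 and to which the transitions into $s_1$ and $s_2$ are redirected. The relation $\sqsubseteq$ is *$\mathsf X$-$\mathsf Y$-$\mathcal M$-monotone* if for every $m\in M$ and all $(\mathcal A_1,s_1),(\mathcal A_2,s_2)$ in the class given by $\mathsf Y$ there is $i\in\{1,2\}$ such that for all $w\in L_{m_{\rm init},m}$, $$w\,\mathrm{Cols}(\mathcal A_{3-i},s_{3-i})\sqsubseteq w\,\mathrm{Cols}(\mathcal A_i,s_i).$$ It is *$\mathsf X$-$\mathsf Y$-$\mathcal M$-selective* if for every $m\in M$, all $(\mathcal A_1,s_1),(\mathcal A_2,s_2)$ in that class such that for $i=1,2$ the color words of all histories of $\mathcal A_i$ from $s_i$ to $s_i$ are in $L_{m,m}$, and all $w\in L_{m_{\rm init},m}$, $$w\,\mathrm{Cols}\bigl((\mathcal A_1,s_1)\sqcup(\mathcal A_2,s_2),t\bigr)\sqsubseteq w\,\mathrm{Cols}(\mathcal A_1,s_1)\cup w\,\mathrm{Cols}(\mathcal A_2,s_2).$$ **Theorem.** Let $\sqsubseteq$ be a preference relation, $\mathcal M$ a memory skeleton, $\mathsf X$ a type of strategies and $\mathsf Y\in\{\mathsf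 D,\mathsf S\}$. Assume that $\mathsf X\in\{\mathsf{PFM},\mathsf P\}$ and $\mathsf Y=\mathsf D$, or that mixing is useless for $\sqsubseteq$. Then the following are equivalent: 1. every initialized one-player arena of player 1 in the class given by $\mathsf Y$ admits a pure strategy of player 1 that is based on $\mathcal M$ and is $\mathsf X$-optimal; 2. $\sqsubseteq$ is $\mathsf X$-$\mathsf Y$-$\mathcal M$-monotone and $\mathsf X$-$\mathsf Y$-$\mathcal M$-selective. Moreover, mixing is useless for every preference relation given by a real payoff function, that is: let $f:C^\omega\to\mathbb R$ be measurable and such that the expectation $\mathbb E_\mu[f]\in[-\infty,\infty]$ is well defined for every $\mu\in\mathcal D$ (the positive and the negative part of $f$ do not both have infinite integral); then mixing is useless for the relation $\mu\sqsubseteq\mu'\iff\mathbb E_\mu[f]\le\mathbb E_{\mu'}[f]$. -/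

import Mathlib

open MeasureTheory ProbabilityTheory
open scoped NNReal ENNReal

noncomputable section

/-! ### Infinite words over an arbitrary set of colors -/

/-- Infinite words of colors. -/
def Words (C : Type*) : Type _ := ℕ → C

/-- The cylinder of a finite word `u`: all infinite words that have `u` as a prefix. -/
def wordCyl {C : Type*} (u : List C) : Set (Words C) :=
  {x | ∀ i (h : i < u.length), x i = u[i]}

/-- The σ-algebra generated by the cylinders of finite words. -/
instance instMeasurableSpaceWords {C : Type*} : MeasurableSpace (Words C) :=
  MeasurableSpace.generateFrom (Set.range wordCyl)

/-- The infinite word `w x`. -/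
def prepend {C : Type*} (w : List C) (x : Words C) : Words C :=
  fun i => if h : i < w.length then w[i] else x (i - w.length)

theorem measurable_prepend {C : Type*} (w : List C) : Measurable (prepend w) := by
  refine measurable_generateFrom ?_
  rintro _ ⟨u, rfl⟩
  by_cases hu : ∀ i (h : i < u.length) (h2 : i < w.length), w[i] = u[i]
  · have : prepend w ⁻¹' wordCyl u = wordCyl (u.drop w.length) := by
      ext x
      simp only [Set.mem_preimage, wordCyl, Set.mem_ofPred_eq, prepend, List.length_drop,
        List.getElem_drop]
      constructor
      · intro H i hi
        have := H (w.length + i) (by omega)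
        simpa using this
      · intro H i hi
        by_cases h2 : i < w.length
        · simpa [h2] using hu i hi h2
        · have := H (i - w.length) (by omega)
          simp only [h2, dite_false]
          rw [this]
          congr 1
          omega
    rw [this]
    exact MeasurableSpace.measurableSet_generateFrom ⟨_, rfl⟩
  · have : prepend w ⁻¹' wordCyl u = ∅ := by
      ext x
      simp only [Set.mem_preimage, wordCyl, Set.mem_ofPred_eq, prepend, Set.mem_empty_iff_false,
        iff_false]
      intro H
      refine hu fun i h h2 => ?_
      simpa [h2] using H i h
    rw [this]
    exact MeasurableSet.empty

/-- The distribution `w μ`: the law of `w x` when `x` has law `μ`. -/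
def shiftDist {C : Type*} (w : List C) (μ : ProbabilityMeasure (Words C)) :
    ProbabilityMeasure (Words C) :=
  μ.map (measurable_prepend w).aemeasurable

/-! ### Preference relations -/

/-- A preference relation of player 1: a total preorder on the distributions over infinite
words of colors; `rel μ μ'` says that `μ'` is at least as good as `μ`. -/
structure Preference (C : Type*) where
  rel : ProbabilityMeasure (Words C) → ProbabilityMeasure (Words C) → Prop
  total : ∀ μ μ', rel μ μ' ∨ rel μ' μ
  trans : ∀ μ μ' μ'', rel μ μ' → rel μ' μ'' → rel μ μ''

/-- The comparison of sets of distributions: every element of `S` is dominated by some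
element of `T`. -/
def Preference.setRel {C : Type*} (pref : Preference C)
    (S T : Set (ProbabilityMeasure (Words C))) : Prop :=
  ∀ μ ∈ S, ∃ μ' ∈ T, pref.rel μ μ'

/-- The convex combination `∑ i, lam i • μ i`. -/
def mix {C : Type*} {I : Type} (lam : I → ℝ≥0) (hlam : ∑' i, (lam i : ℝ≥0∞) = 1)
    (μ : I → ProbabilityMeasure (Words C)) : ProbabilityMeasure (Words C) :=
  ⟨Measure.sum fun i => (lam i : ℝ≥0∞) • (μ i : Measure (Words C)), ⟨by
    rw [Measure.sum_apply _ MeasurableSet.univ]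
    simpa using hlam⟩⟩

/-- Mixing is useless: countable convex combinations preserve the preference. -/
def MixingUseless {C : Type*} (pref : Preference C) : Prop :=
  ∀ (I : Type) [Countable I] (lam : I → ℝ≥0) (_ : ∀ i, 0 < lam i)
    (hlam : ∑' i, (lam i : ℝ≥0∞) = 1) (μ μ' : I → ProbabilityMeasure (Words C)),
    (∀ i, pref.rel (μ i) (μ' i)) → pref.rel (mix lam hlam μ) (mix lam hlam μ')

/-- The integral of the positive part of `f`. -/
def integralPos {C : Type*} (f : Words C → ℝ) (μ : ProbabilityMeasure (Words C)) : ℝ≥0∞ :=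
  ∫⁻ x, ENNReal.ofReal (f x) ∂(μ : Measure (Words C))

/-- The expectation of `f` is well defined (possibly infinite) under every distribution. -/
def ExpectationWellDefined {C : Type*} (f : Words C → ℝ) : Prop :=
  ∀ μ : ProbabilityMeasure (Words C), integralPos f μ ≠ ⊤ ∨ integralPos (fun x => -f x) μ ≠ ⊤

/-- The expectation of `f` as an extended real number (the integral of the positive part minus
the integral of the negative part; meaningful when not both are infinite). -/
def expectation {C : Type*} (f : Words C → ℝ) (μ : ProbabilityMeasure (Words C)) : EReal :=
  (integralPos f μ : EReal) - (integralPos (fun x => -f x) μ : EReal)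

/-- The preference relation of a payoff function: compare the expected payoffs. -/
def payoffPreference {C : Type*} (f : Words C → ℝ) : Preference C where
  rel μ μ' := expectation f μ ≤ expectation f μ'
  total _ _ := le_total _ _
  trans _ _ _ := le_trans

/-! ### Arenas -/

/-- The two players. -/
inductive Player
  | one
  | two

/-- Finite two-player stochastic turn-based arenas with colors on the state-action pairs. The
maps `trans` and `col` only matter at pairs `(s, a)` with `a ∈ avail s`. -/
structure Arena (C : Type*) where
  State : Type
  Act : Type
  finState : Finite State
  finAct : Finite Act
  owner : State → Player
  avail : State → Set Act
  avail_nonempty : ∀ s, (avail s).Nonempty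
  trans : State → Act → PMF State
  col : State → Act → C

namespace Arena

variable {C : Type*}

instance instFiniteState (A : Arena C) : Finite A.State := A.finState

instance instFiniteAct (A : Arena C) : Finite A.Act := A.finAct

/-- State-action pairs. -/
def Step (A : Arena C) : Type := A.State × A.Act

instance instFiniteStep (A : Arena C) : Finite A.Step :=
  inferInstanceAs (Finite (A.State × A.Act))

instance instMeasurableSpaceStep (A : Arena C) : MeasurableSpace A.Step := ⊤

instance instDiscreteStep (A : Arena C) : DiscreteMeasurableSpace A.Step :=
  ⟨fun _ => trivial⟩

/-- `A.IsHist I l s`: the steps `l = [(s₀, a₁), (s₁, a₂), …, (sₙ₋₁, aₙ)]` followed by the last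
state `s` form a history `s₀ a₁ s₁ … aₙ s` of `A` that starts in a state of `I`. -/
inductive IsHist (A : Arena C) (I : Set A.State) : List A.Step → A.State → Prop
  | nil {s : A.State} : s ∈ I → IsHist A I [] s
  | snoc {l : List A.Step} {s s' : A.State} {a : A.Act} : IsHist A I l s → a ∈ A.avail s →
      s' ∈ (A.trans s a).support → IsHist A I (l ++ ([(s, a)] : List A.Step)) s'

/-- The sequence of colors of a history. -/
def colors (A : Arena C) (l : List A.Step) : List C := l.map fun p => A.col p.1 p.2

/-- `(A, I)` is an initialized arena: `I` is nonempty and all states are reachable from `I`. -/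
def IsInit (A : Arena C) (I : Set A.State) : Prop :=
  I.Nonempty ∧ ∀ s, ∃ l, A.IsHist I l s

/-- One-player arenas of player 1: player 2 never has a choice. -/
def OnePlayer (A : Arena C) : Prop :=
  ∀ s, A.owner s = Player.two → ∃ a, A.avail s = {a}

/-- Deterministic arenas. -/
def Deterministic (A : Arena C) : Prop :=
  ∀ s, ∀ a ∈ A.avail s, ∃ s', (A.trans s a).support = {s'}

end Arena

/-- The classes of arenas: deterministic ones, or all (stochastic) ones. -/
inductive ArenaType
  | det
  | stoch

/-- The one-player arenas of player 1 in a class. -/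
def ArenaType.Mem {C : Type*} (Y : ArenaType) (A : Arena C) : Prop :=
  A.OnePlayer ∧ match Y with
    | .det => A.Deterministic
    | .stoch => True

/-! ### Memory skeletons and strategies -/

/-- Memory skeletons: possibly infinite color-reading automata of which only finitely many
states are reachable with finitely many colors. -/
structure MemorySkeleton (C : Type*) where
  Mem : Type*
  init : Mem
  upd : Mem → C → Mem
  finite_reach : ∀ B : Set C, B.Finite →
    {m | ∃ w : List C, (∀ c ∈ w, c ∈ B) ∧ w.foldl upd init = m}.Finite

/-- The extension of the update function to finite words. -/
def MemorySkeleton.run {C : Type*} (M : MemorySkeleton C) (m : M.Mem) (w : List C) : M.Mem :=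
  w.foldl M.upd m

/-- The language `L_{m₁,m₂}` of the finite words that lead from `m₁` to `m₂`. -/
def MemorySkeleton.lang {C : Type*} (M : MemorySkeleton C) (m₁ m₂ : M.Mem) : Set (List C) :=
  {w | M.run m₁ w = m₂}

namespace Arena

variable {C : Type*}

/-- Strategies map histories to distributions over actions. Values matter only at the histories
that end in a state of the player; the constraints below are imposed only there. -/
abbrev Strat (A : Arena C) : Type := List A.Step → A.State → PMF A.Act

/-- `σ` is a strategy of player `i` on `(A, I)`: it only plays available actions. -/
def IsStrat (A : Arena C) (I : Set A.State) (i : Player) (σ : A.Strat) : Prop :=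
  ∀ l s, A.IsHist I l s → A.owner s = i → (σ l s).support ⊆ A.avail s

/-- Pure strategies. -/
def IsPure (A : Arena C) (I : Set A.State) (i : Player) (σ : A.Strat) : Prop :=
  ∀ l s, A.IsHist I l s → A.owner s = i → ∃ a, (σ l s).support = {a}

/-- Finite-memory strategies: those encoded by a finite Mealy machine that reads the history
state-action pair by state-action pair. -/
def IsFiniteMemory (A : Arena C) (I : Set A.State) (i : Player) (σ : A.Strat) : Prop :=
  ∃ (N : Type) (_ : Finite N) (n₀ : N) (upd : N → A.Step → N)
    (nxt : A.State → N → PMF A.Act),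
    (∀ s n, A.owner s = i → (nxt s n).support ⊆ A.avail s) ∧
    ∀ l s, A.IsHist I l s → A.owner s = i → σ l s = nxt s (l.foldl upd n₀)

/-- Strategies based on the memory skeleton `M`: they only depend on the current state and on
the memory state reached by reading the colors of the history. -/
def IsBasedOn (A : Arena C) (M : MemorySkeleton C) (I : Set A.State) (i : Player)
    (σ : A.Strat) : Prop :=
  ∃ nxt : A.State → M.Mem → PMF A.Act,
    (∀ s m, A.owner s = i → (nxt s m).support ⊆ A.avail s) ∧
    ∀ l s, A.IsHist I l s → A.owner s = i → σ l s = nxt s (M.run M.init (A.colors l))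

end Arena

/-- The types of strategies: pure finite-memory, pure, randomized finite-memory, and general
(randomized, with arbitrary memory). -/
inductive StratType
  | pureFM
  | pure
  | randFM
  | general

namespace Arena

variable {C : Type*}

/-- The strategies of type `X` of player `i` on `(A, I)`. -/
def strats (A : Arena C) (X : StratType) (I : Set A.State) (i : Player) : Set A.Strat :=
  {σ | A.IsStrat I i σ ∧ match X with
    | .pureFM => A.IsPure I i σ ∧ A.IsFiniteMemory I i σ
    | .pure => A.IsPure I i σ
    | .randFM => A.IsFiniteMemory I i σ
    | .general => True}

/-! ### Distributions over plays and over infinite words of colors -/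

/-- The joint strategy of the two players: the owner of the current state decides. -/
def joint (A : Arena C) (σ₁ σ₂ : A.Strat) : A.Strat := fun l s =>
  match A.owner s with
  | .one => σ₁ l s
  | .two => σ₂ l s

/-- The law of the first step from `s`. -/
def firstStep (A : Arena C) (σ : A.Strat) (s : A.State) : PMF A.Step :=
  (σ [] s).map fun a => (s, a)

/-- The law of the step that follows the steps `l`, the last of which is `p`. -/
def nextStep (A : Arena C) (σ : A.Strat) (l : List A.Step) (p : A.Step) : PMF A.Step :=
  (A.trans p.1 p.2).bind fun s' => (σ l s').map fun a => (s', a)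

/-- The transition kernels of the process of steps. -/
def stepKernel (A : Arena C) (σ : A.Strat) (n : ℕ) :
    Kernel ((_ : Finset.Iic n) → A.Step) A.Step :=
  Kernel.ofFunOfCountable fun h =>
    (A.nextStep σ (List.ofFn fun i : Fin (n + 1) => h ⟨i, Finset.mem_Iic.2 (by omega)⟩)
      (h ⟨n, Finset.mem_Iic.2 le_rfl⟩)).toMeasure

instance instIsMarkovKernelStepKernel (A : Arena C) (σ : A.Strat) (n : ℕ) :
    IsMarkovKernel (A.stepKernel σ n) :=
  ⟨fun _ => PMF.toMeasure.isProbabilityMeasure _⟩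

/-- The law of the play `s₀ a₁ s₁ a₂ …`, as a sequence of steps, from `s` under `σ₁`, `σ₂`. -/
def playDist (A : Arena C) (s : A.State) (σ₁ σ₂ : A.Strat) : Measure (ℕ → A.Step) :=
  Kernel.trajMeasure (X := fun _ => A.Step) (A.firstStep (A.joint σ₁ σ₂) s).toMeasure
    (A.stepKernel (A.joint σ₁ σ₂))

instance instIsProbabilityMeasurePlayDist (A : Arena C) (s : A.State) (σ₁ σ₂ : A.Strat) :
    IsProbabilityMeasure (A.playDist s σ₁ σ₂) := by
  unfold playDist
  infer_instance

/-- The infinite word of colors of a play. -/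
def colWord (A : Arena C) (π : ℕ → A.Step) : Words C := fun n => A.col (π n).1 (π n).2

theorem measurable_colWord (A : Arena C) : Measurable A.colWord := by
  refine measurable_generateFrom ?_
  rintro _ ⟨u, rfl⟩
  have : A.colWord ⁻¹' wordCyl u =
      ⋂ i : Fin u.length, (fun π : ℕ → A.Step => π i) ⁻¹' {p | A.col p.1 p.2 = u[i]} := by
    ext π
    simp [wordCyl, colWord, Fin.forall_iff]
  rw [this]
  exact MeasurableSet.iInter fun i =>
    measurable_pi_apply (i : ℕ) (MeasurableSet.of_discrete)

/-- The distribution over infinite words of colors induced from `s` by two strategies. -/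
def colDist (A : Arena C) (s : A.State) (σ₁ σ₂ : A.Strat) : ProbabilityMeasure (Words C) :=
  ⟨(A.playDist s σ₁ σ₂).map A.colWord,
    Measure.isProbabilityMeasure_map A.measurable_colWord.aemeasurable⟩

/-- The distributions that player 1 can induce from `s` with strategies of type `X`; used in
one-player arenas of player 1, where player 2 has no choice. -/
def cols (A : Arena C) (X : StratType) (s : A.State) : Set (ProbabilityMeasure (Words C)) :=
  {μ | ∃ σ₁ ∈ A.strats X {s} Player.one, ∃ σ₂ ∈ A.strats X {s} Player.two,
    μ = A.colDist s σ₁ σ₂}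

/-! ### Optimality -/

/-- The upward closure of the set of distributions that player 2 can induce against `σ₁`. -/
def upCols (A : Arena C) (pref : Preference C) (X : StratType) (s : A.State) (σ₁ : A.Strat) :
    Set (ProbabilityMeasure (Words C)) :=
  {μ | ∃ σ₂ ∈ A.strats X {s} Player.two, pref.rel (A.colDist s σ₁ σ₂) μ}

/-- `σ₁` is `X`-optimal for player 1 in `(A, I)`: it is a strategy of type `X` that is at least
as good as all the others of type `X`, from all the initial states. -/
def IsOptimal (A : Arena C) (pref : Preference C) (X : StratType) (I : Set A.State)
    (σ₁ : A.Strat) : Prop :=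
  σ₁ ∈ A.strats X I Player.one ∧
    ∀ σ₁' ∈ A.strats X I Player.one, ∀ s ∈ I, A.upCols pref X s σ₁ ⊆ A.upCols pref X s σ₁'

end Arena

/-- Pure strategies based on `M` suffice for player 1 to play `X`-optimally in all the
initialized one-player arenas of player 1 of class `Y`. -/
def PureSuffice {C : Type*} (M : MemorySkeleton C) (pref : Preference C) (X : StratType)
    (Y : ArenaType) : Prop :=
  ∀ (A : Arena C) (I : Set A.State), Y.Mem A → A.IsInit I →
    ∃ σ : A.Strat, A.IsPure I Player.one σ ∧ A.IsBasedOn M I Player.one σ ∧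
      A.IsOptimal pref X I σ

/-! ### Merging two arenas -/

namespace Arena

variable {C : Type*}

open Classical in
/-- The map from the states of an arena to the states of the merge: `s₀` becomes the merged
state `none`, the other states are kept. -/
def redirect {S T : Type} (s₀ : S) (emb : {s // s ≠ s₀} → T) (s : S) : Option T :=
  if h : s = s₀ then none else some (emb ⟨s, h⟩)

/-- The merge of `(A₁, s₁)` and `(A₂, s₂)`: the disjoint union (of states and of actions) of the
two arenas in which `s₁` and `s₂` are replaced by one state `none`, controlled by player 1, in
which the actions of `s₁` and those of `s₂` are available. -/
def merge (A₁ A₂ : Arena C) (s₁ : A₁.State) (s₂ : A₂.State) : Arena C where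
  State := Option ({s // s ≠ s₁} ⊕ {s // s ≠ s₂})
  Act := A₁.Act ⊕ A₂.Act
  finState := inferInstance
  finAct := inferInstance
  owner
    | none => Player.one
    | some (.inl s) => A₁.owner s
    | some (.inr s) => A₂.owner s
  avail
    | none => Sum.inl '' A₁.avail s₁ ∪ Sum.inr '' A₂.avail s₂
    | some (.inl s) => Sum.inl '' A₁.avail s
    | some (.inr s) => Sum.inr '' A₂.avail s
  avail_nonempty
    | none => ((A₁.avail_nonempty s₁).image _).inl
    | some (.inl s) => (A₁.avail_nonempty s).image _
    | some (.inr s) => (A₂.avail_nonempty s).image _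
  trans
    | none, .inl a => (A₁.trans s₁ a).map (redirect s₁ .inl)
    | none, .inr a => (A₂.trans s₂ a).map (redirect s₂ .inr)
    | some (.inl s), .inl a => (A₁.trans s a).map (redirect s₁ .inl)
    | some (.inr s), .inr a => (A₂.trans s a).map (redirect s₂ .inr)
    -- the remaining pairs are unavailable
    | some (.inl _), .inr _ => PMF.pure none
    | some (.inr _), .inl _ => PMF.pure none
  col
    | none, .inl a => A₁.col s₁ a
    | none, .inr a => A₂.col s₂ a
    | some (.inl s), .inl a => A₁.col s a
    | some (.inr s), .inr a => A₂.col s a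
    -- the remaining pairs are unavailable
    | some (.inl _), .inr a => A₂.col s₂ a
    | some (.inr _), .inl a => A₁.col s₁ a

/-- The merged state. -/
def mergeState (A₁ A₂ : Arena C) (s₁ : A₁.State) (s₂ : A₂.State) : (A₁.merge A₂ s₁ s₂).State :=
  (none : Option ({s // s ≠ s₁} ⊕ {s // s ≠ s₂}))

end Arena

/-! ### Monotony and selectivity -/

/-- `X`-`Y`-`M`-monotony of a preference relation. -/
def IsMonotone {C : Type*} (X : StratType) (Y : ArenaType) (M : MemorySkeleton C)
    (pref : Preference C) : Prop :=
  ∀ (m : M.Mem) (A₁ A₂ : Arena C) (s₁ : A₁.State) (s₂ : A₂.State),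
    Y.Mem A₁ → A₁.IsInit {s₁} → Y.Mem A₂ → A₂.IsInit {s₂} →
    (∀ w ∈ M.lang M.init m,
      pref.setRel (shiftDist w '' A₁.cols X s₁) (shiftDist w '' A₂.cols X s₂)) ∨
    (∀ w ∈ M.lang M.init m,
      pref.setRel (shiftDist w '' A₂.cols X s₂) (shiftDist w '' A₁.cols X s₁))

/-- `X`-`Y`-`M`-selectivity of a preference relation. -/
def IsSelective {C : Type*} (X : StratType) (Y : ArenaType) (M : MemorySkeleton C)
    (pref : Preference C) : Prop :=
  ∀ (m : M.Mem) (A₁ A₂ : Arena C) (s₁ : A₁.State) (s₂ : A₂.State),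
    Y.Mem A₁ → A₁.IsInit {s₁} → Y.Mem A₂ → A₂.IsInit {s₂} →
    (∀ l, A₁.IsHist {s₁} l s₁ → A₁.colors l ∈ M.lang m m) →
    (∀ l, A₂.IsHist {s₂} l s₂ → A₂.colors l ∈ M.lang m m) →
    ∀ w ∈ M.lang M.init m,
      pref.setRel
        (shiftDist w '' (A₁.merge A₂ s₁ s₂).cols X (A₁.mergeState A₂ s₁ s₂))
        (shiftDist w '' A₁.cols X s₁ ∪ shiftDist w '' A₂.cols X s₂)

end

/-! A pair of strategies is run as one Mealy machine that moves for both players (`Arena.Machine`,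
`mem_cols_iff`); in one-player arenas nothing is lost, because the strategy of player 2 is
irrelevant. Laws of machines satisfy a one-step equation (`law_apply`), and machines that can be
kept related step by step have equal laws (`law_eq_of_related`). Every transfer between arenas rests
on these two facts.

From monotony and selectivity to strategies: in the product of an arena with the finitely many
memory states it can reach, each state carries a memory label, and memoryless strategies become
strategies based on the skeleton. `exists_memoryless_dominating` finds, by induction on the number
of available state-action pairs, a memoryless strategy that is best from every state after every
word leading to its label. If a state `t` offers a choice, its actions are split in two, and both
smaller arenas are solved by induction. Seen from `t`, the arena is covered by the merge of the two,
so selectivity reduces each behaviour from `t` to one half, and monotony selects a half that wins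
after all words at once. From any other state, a machine is compared with the one that switches to
the winning memoryless strategy on reaching `t`. Both laws are mixtures over the paths to `t`, with
the same weights and the same remainder (`SolvesOutside.exists_rest`), so useless mixing gives the
comparison; with pure strategies in deterministic arenas the mixture has a single component. The
switched machine only uses actions of the smaller arena, where the induction hypothesis applies.

From strategies to monotony and selectivity (`PureSuffice.merge`): two words that lead to the same
memory state `m` are put in front of a merge of two arenas. An optimal strategy based on the
skeleton reaches the root with memory `m` after either word and chooses one side. Cycles at the root
preserve `m`, so it stays on that side, which is therefore at least as good after both words. Equal
words give selectivity. Two words that witness the failure of monotony in opposite directions give a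
contradiction, once the roots are replaced by copies that are never revisited.

For payoffs, comparing expectations amounts to an inequality between sums of positive and negative
parts in `[0, ∞]`, which countable mixtures preserve. -/

noncomputable section

/-! ### Cylinders -/

@[simp] theorem wordCyl_nil {C : Type*} : wordCyl ([] : List C) = Set.univ := by
  ext x; simp [wordCyl]

theorem measurableSet_wordCyl {C : Type*} (u : List C) : MeasurableSet (wordCyl u) :=
  MeasurableSpace.measurableSet_generateFrom ⟨u, rfl⟩

theorem wordCyl_subset_of_nonempty_inter {C : Type*} {u v : List C} (huv : u.length ≤ v.length)
    (h : (wordCyl u ∩ wordCyl v).Nonempty) : wordCyl v ⊆ wordCyl u := by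
  obtain ⟨x, hu, hv⟩ := h
  intro y hy i hi
  rw [hy i (hi.trans_le huv), ← hv i (hi.trans_le huv), hu i hi]

/-- Cylinders that meet are nested. -/
theorem isPiSystem_range_wordCyl {C : Type*} :
    IsPiSystem (Set.range (wordCyl : List C → Set (Words C))) := by
  rintro _ ⟨u, rfl⟩ _ ⟨v, rfl⟩ h
  rcases le_total u.length v.length with huv | huv
  · exact ⟨v, (Set.inter_eq_right.2 (wordCyl_subset_of_nonempty_inter huv h)).symm⟩
  · rw [Set.inter_comm] at h
    exact ⟨u, (Set.inter_eq_left.2 (wordCyl_subset_of_nonempty_inter huv h)).symm⟩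

/-- Makes equality of laws accessible to induction on a finite word, over any set of colors. -/
theorem measure_ext_wordCyl {C : Type*} {μ ν : Measure (Words C)} [IsFiniteMeasure μ]
    (h : ∀ u, μ (wordCyl u) = ν (wordCyl u)) : μ = ν := by
  refine ext_of_generate_finite (Set.range wordCyl) rfl isPiSystem_range_wordCyl ?_ ?_
  · rintro _ ⟨u, rfl⟩
    exact h u
  · simpa using h []

theorem probabilityMeasure_ext_wordCyl {C : Type*} {μ ν : ProbabilityMeasure (Words C)}
    (h : ∀ u, (μ : Measure (Words C)) (wordCyl u) = (ν : Measure (Words C)) (wordCyl u)) :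
    μ = ν :=
  Subtype.ext (measure_ext_wordCyl (μ := (μ : Measure (Words C))) h)

/-- The sequences with a given prefix. -/
def prefixSet {D : Type*} (l : List D) : Set (ℕ → D) :=
  {x | ∀ i (h : i < l.length), x i = l[i]}

theorem measurableSet_prefixSet {D : Type*} [MeasurableSpace D] [DiscreteMeasurableSpace D]
    (l : List D) : MeasurableSet (prefixSet l) := by
  have : prefixSet l = ⋂ i : Fin l.length, (fun x : ℕ → D => x i) ⁻¹' {l[i]} := by
    ext x
    simp [prefixSet, Fin.forall_iff]
  rw [this]
  exact MeasurableSet.iInter fun i => measurable_pi_apply (i : ℕ) (MeasurableSet.of_discrete)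

theorem pi_eq_generateFrom_prefixSet {D : Type*} [MeasurableSpace D] [DiscreteMeasurableSpace D]
    [Countable D] : (MeasurableSpace.pi : MeasurableSpace (ℕ → D)) =
      MeasurableSpace.generateFrom (Set.range prefixSet) := by
  apply le_antisymm
  · refine iSup_le fun i => ?_
    rintro _ ⟨B, -, rfl⟩
    have : (fun x : ℕ → D => x i) ⁻¹' B =
        -- The union is countable since `D` is; prefixes are only required to be long enough to show
        -- the coordinate `i`.
        ⋃ l : {l : List D // ∃ h : i < l.length, l[i] ∈ B}, prefixSet l.1 := by
      ext x
      simp only [Set.mem_preimage, Set.mem_iUnion]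
      constructor
      · intro hx
        exact ⟨⟨List.ofFn fun j : Fin (i + 1) => x j, by simp, by rwa [List.getElem_ofFn]⟩,
          fun j hj => by rw [List.getElem_ofFn]⟩
      · rintro ⟨⟨l, hl, hB⟩, hx⟩
        rw [hx i hl]
        exact hB
    rw [this]
    exact MeasurableSet.iUnion fun l => MeasurableSpace.measurableSet_generateFrom ⟨_, rfl⟩
  · refine MeasurableSpace.generateFrom_le ?_
    rintro _ ⟨l, rfl⟩
    exact measurableSet_prefixSet l

theorem measure_ext_prefixSet {D : Type*} [MeasurableSpace D] [DiscreteMeasurableSpace D]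
    [Countable D] {μ ν : Measure (ℕ → D)} [IsFiniteMeasure μ]
    (h : ∀ u, μ (prefixSet u) = ν (prefixSet u)) : μ = ν := by
  -- `prefixSet` and `wordCyl` unfold to the same sets; only the ambient σ-algebra is presented
  -- differently.
  refine ext_of_generate_finite (Set.range prefixSet) pi_eq_generateFrom_prefixSet
    (isPiSystem_range_wordCyl (C := D)) ?_ ?_
  · rintro _ ⟨u, rfl⟩
    exact h u
  · simpa [prefixSet] using h []

theorem prepend_append {C : Type*} (v w : List C) (x : Words C) :
    prepend (v ++ w) x = prepend v (prepend w x) := by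
  funext i
  by_cases h1 : i < v.length
  · have : i < v.length + w.length := by omega
    simp [prepend, h1, this]
  · by_cases h2 : i < v.length + w.length
    · have : i - v.length < w.length := by omega
      simp [prepend, h1, this, h2, List.getElem_append]
    · have : ¬ i - v.length < w.length := by omega
      simp only [prepend, h1, this, h2, List.length_append, dite_false]
      congr 1
      omega

/-- The recursion step on cylinders: reading a color either consumes the first letter or leaves
nothing. -/
theorem prepend_singleton_preimage_cons {C : Type*} [DecidableEq C] (c d : C) (u : List C) :
    prepend [c] ⁻¹' wordCyl (d :: u) = if c = d then wordCyl u else ∅ := by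
  split_ifs with h
  · subst h
    ext x
    simp only [Set.mem_preimage, wordCyl, Set.mem_ofPred_eq, prepend]
    constructor
    · intro H i hi
      have := H (i + 1) (by simpa using hi)
      simpa using this
    · rintro H (_ | i) hi
      · simp
      · simpa using H i (by simpa using hi)
  · ext x
    simp only [Set.mem_preimage, wordCyl, Set.mem_ofPred_eq, prepend, Set.mem_empty_iff_false,
      iff_false]
    intro H
    exact h (by have := H 0 (by simp); simpa only [List.length_singleton, zero_lt_one, dite_true, List.getElem_cons_zero] using this)

@[simp] theorem coe_shiftDist {C : Type*} (w : List C) (μ : ProbabilityMeasure (Words C)) :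
    (shiftDist w μ : Measure (Words C)) = (μ : Measure (Words C)).map (prepend w) := rfl

theorem shiftDist_nil {C : Type*} (μ : ProbabilityMeasure (Words C)) : shiftDist [] μ = μ := by
  apply Subtype.ext
  exact Measure.map_id

theorem shiftDist_append {C : Type*} (v w : List C) (μ : ProbabilityMeasure (Words C)) :
    shiftDist (v ++ w) μ = shiftDist v (shiftDist w μ) := by
  apply Subtype.ext
  change (μ : Measure (Words C)).map _ = ((μ : Measure (Words C)).map _).map _
  rw [Measure.map_map (measurable_prepend v) (measurable_prepend w)]
  congr 1
  funext x
  exact prepend_append v w x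

/-! ### Sums over probability mass functions -/

theorem PMF.tsum_map_mul {α β : Type*} (p : PMF α) (k : α → β) (F : β → ℝ≥0∞) :
    ∑' b, p.map k b * F b = ∑' x, p x * F (k x) := by
  classical
  simp_rw [PMF.map_apply, ← ENNReal.tsum_mul_right]
  rw [ENNReal.tsum_comm]
  refine tsum_congr fun x => ?_
  rw [tsum_eq_single (k x)]
  · simp
  · intro b hb
    simp [hb]

theorem PMF.tsum_congr_support {α : Type*} (p : PMF α) {F G : α → ℝ≥0∞}
    (h : ∀ x ∈ p.support, F x = G x) : ∑' x, p x * F x = ∑' x, p x * G x := by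
  refine tsum_congr fun x => ?_
  by_cases hx : p x = 0
  · simp [hx]
  · rw [h x ((PMF.mem_support_iff _ _).2 hx)]

theorem prefixSet_append_singleton {D : Type*} (l : List D) (q : D) :
    prefixSet (l ++ [q]) = prefixSet l ∩ {x | x l.length = q} := by
  ext x
  simp only [prefixSet, Set.mem_inter_iff, Set.mem_ofPred_eq]
  constructor
  · intro h
    refine ⟨fun i hi => ?_, ?_⟩
    · rw [h i (by simp; omega), List.getElem_append_left hi]
    · rw [h l.length (by simp)]; simp
  · rintro ⟨h1, h2⟩ i hi
    by_cases hil : i < l.length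
    · rw [h1 i hil, List.getElem_append_left hil]
    · have : i = l.length := by simp at hi; omega
      subst this
      rw [h2]; simp

/-! ### Trajectories in a countable discrete space -/

section Trajectory

variable {D : Type*} [MeasurableSpace D] [DiscreteMeasurableSpace D] (μ₀ : Measure D)
  (κ : (n : ℕ) → Kernel ((_ : Finset.Iic n) → D) D) [∀ n, IsMarkovKernel (κ n)]

theorem trajMeasure_prefixSet_singleton (q : D) :
    Kernel.trajMeasure (X := fun _ => D) μ₀ κ (prefixSet [q]) = μ₀ {q} := by
  have h0 : prefixSet [q] = (fun x : ℕ → D => x 0) ⁻¹' {q} := by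
    ext x; simp [prefixSet]
  have h1 : (fun x : ℕ → D => x 0) =
      (fun h : ((i : Finset.Iic 0) → D) => h ⟨0, by simp⟩) ∘
        Preorder.frestrictLe (π := fun _ => D) 0 := rfl
  have h2 : ((fun h : ((i : Finset.Iic 0) → D) => h ⟨0, by simp⟩) ∘
      (MeasurableEquiv.piUnique fun _ : Finset.Iic 0 => D).symm) = id := rfl
  have hm : Measurable fun h : ((i : Finset.Iic 0) → D) => h ⟨0, by simp⟩ :=
    measurable_pi_apply _
  rw [h0, ← Measure.map_apply (measurable_pi_apply 0) (MeasurableSet.of_discrete),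
    Kernel.trajMeasure, h1, ← Measure.map_map hm
    (Preorder.measurable_frestrictLe 0), Measure.map_comp _ _ (Preorder.measurable_frestrictLe 0),
    Kernel.traj_map_frestrictLe, Kernel.partialTraj_self, Measure.id_comp]
  erw [Measure.map_map hm (MeasurableEquiv.measurable _), h2]
  rw [Measure.map_id]

variable [Countable D] [IsProbabilityMeasure μ₀]

/-- The chain rule: the joint law of the past and the next coordinate is the composition-product of
the law of the past with the kernel. -/
theorem trajMeasure_prefixSet_append (l : List D) (p q : D) :
    Kernel.trajMeasure (X := fun _ => D) μ₀ κ (prefixSet (l ++ [p] ++ [q])) =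
      Kernel.trajMeasure (X := fun _ => D) μ₀ κ (prefixSet (l ++ [p])) *
        κ l.length (fun i => (l ++ [p])[(i : ℕ)]'(by
          have := Finset.mem_Iic.1 i.2; simp; omega)) {q} := by
  set h : (_ : Finset.Iic l.length) → D := fun i => (l ++ [p])[(i : ℕ)]'(by
    have := Finset.mem_Iic.1 i.2; simp; omega) with hh
  have h0 : prefixSet (l ++ [p]) = Preorder.frestrictLe (π := fun _ => D) l.length ⁻¹' {h} := by
    ext x
    simp only [prefixSet, Set.mem_preimage, Set.mem_singleton_iff, Set.mem_ofPred_eq]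
    constructor
    · intro H
      funext i
      exact H i _
    · intro H i hi
      have hi' : i ∈ Finset.Iic l.length := by simp at hi ⊢; omega
      exact congrFun H ⟨i, hi'⟩
  have h1 : prefixSet (l ++ [p] ++ [q]) = (fun x : ℕ → D =>
      (Preorder.frestrictLe (π := fun _ => D) l.length x, x (l.length + 1))) ⁻¹' ({h} ×ˢ {q}) := by
    rw [prefixSet_append_singleton, h0]
    ext x
    simp
  have hm : Measurable fun x : ℕ → D =>
      (Preorder.frestrictLe (π := fun _ => D) l.length x, x (l.length + 1)) :=
    (Preorder.measurable_frestrictLe l.length).prodMk (measurable_pi_apply _)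
  have hsingle : MeasurableSet ({h} : Set ((_ : Finset.Iic l.length) → D)) :=
    measurableSet_singleton h
  rw [h1, ← Measure.map_apply hm (hsingle.prod MeasurableSet.of_discrete),
    ← Kernel.map_frestrictLe_trajMeasure_compProd_eq_map_trajMeasure,
    Measure.compProd_apply_prod hsingle MeasurableSet.of_discrete, lintegral_singleton, h0,
    Measure.map_apply (Preorder.measurable_frestrictLe _) hsingle, mul_comm]

end Trajectory

/-! ### Machines -/

/-- Mealy machines, with finite or infinite memory, that choose actions for both players. -/
structure Arena.Machine {C : Type*} (A : Arena C) where
  N : Type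
  upd : N → A.Step → N
  nxt : A.State → N → PMF A.Act

namespace Arena

variable {C : Type*} {A : Arena C}

/-- The step of playing `a` in `s`. -/
def step (A : Arena C) (s : A.State) (a : A.Act) : A.Step := (s, a)

@[simp] theorem step_fst (s : A.State) (a : A.Act) : (A.step s a).1 = s := rfl

@[simp] theorem step_snd (s : A.State) (a : A.Act) : (A.step s a).2 = a := rfl

theorem eq_step_iff {s : A.State} {a : A.Act} {p : A.Step} :
    p = A.step s a ↔ p.1 = s ∧ p.2 = a := Prod.ext_iff

theorem joint_self (σ : A.Strat) : A.joint σ σ = σ := by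
  funext l s
  unfold joint
  cases A.owner s <;> rfl

namespace Machine

/-- The strategy of a machine that starts in the memory state `n`. -/
def strat (𝓜 : A.Machine) (n : 𝓜.N) : A.Strat := fun l s => 𝓜.nxt s (l.foldl 𝓜.upd n)

/-- The law of the word of colors from `s` under a machine that starts in the memory state `n`. -/
def law (𝓜 : A.Machine) (n : 𝓜.N) (s : A.State) : ProbabilityMeasure (Words C) :=
  A.colDist s (𝓜.strat n) (𝓜.strat n)

/-- The law of the play. -/
def playLaw (𝓜 : A.Machine) (n : 𝓜.N) (s : A.State) : Measure (ℕ → A.Step) :=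
  A.playDist s (𝓜.strat n) (𝓜.strat n)

instance (𝓜 : A.Machine) (n : 𝓜.N) (s : A.State) : IsProbabilityMeasure (𝓜.playLaw n s) := by
  unfold playLaw; infer_instance

theorem coe_law (𝓜 : A.Machine) (n : 𝓜.N) (s : A.State) :
    (𝓜.law n s : Measure (Words C)) = (𝓜.playLaw n s).map A.colWord := rfl

open Classical in
/-- The probability that the play starts with the given steps. -/
def prefixProb (𝓜 : A.Machine) : 𝓜.N → A.State → List A.Step → ℝ≥0∞
  | _, _, [] => 1
  | n, s, p :: l => if p.1 = s then
      𝓜.nxt p.1 n p.2 * ∑' s', A.trans p.1 p.2 s' * prefixProb 𝓜 (𝓜.upd n p) s' l else 0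

open Classical in
theorem map_pair_apply (q : PMF A.Act) (s : A.State) (p : A.Step) :
    (PMF.map (β := A.Step) (fun a => (s, a)) q) p = if p.1 = s then q p.2 else 0 := by
  refine (PMF.map_apply _ _ _).trans ?_
  split_ifs with h
  · rw [tsum_eq_single p.2]
    · exact if_pos (show p = ((s, p.2) : A.State × A.Act) from Prod.ext h rfl)
    · intro a ha
      exact if_neg fun h' => ha (congrArg Prod.snd h').symm
  · exact ENNReal.tsum_eq_zero.2 fun a => if_neg fun h' => h (congrArg Prod.fst h')

theorem prefixProb_singleton (𝓜 : A.Machine) (n : 𝓜.N) (s : A.State) (p : A.Step) :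
    𝓜.prefixProb n s [p] = A.firstStep (𝓜.strat n) s p := by
  classical
  rw [firstStep, map_pair_apply]
  simp only [prefixProb, strat, PMF.tsum_coe, mul_one]
  split_ifs with h
  · rw [h]; rfl
  · rfl

theorem nextStep_apply (σ : A.Strat) (l : List A.Step) (p q : A.Step) :
    A.nextStep σ l p q = A.trans p.1 p.2 q.1 * σ l q.1 q.2 := by
  classical
  rw [nextStep, PMF.bind_apply, tsum_eq_single q.1]
  · rw [map_pair_apply, if_pos rfl]
  · intro s' h
    rw [map_pair_apply, if_neg (Ne.symm h), mul_zero]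

/-- `prefixProb` recurses on the first step, whereas the trajectory measure is extended at the end;
this reconciles the two orders. -/
theorem prefixProb_snoc (𝓜 : A.Machine) (l : List A.Step) (n : 𝓜.N) (s : A.State)
    (p q : A.Step) :
    𝓜.prefixProb n s (l ++ [p] ++ [q]) =
      𝓜.prefixProb n s (l ++ [p]) * A.nextStep (𝓜.strat n) (l ++ [p]) p q := by
  classical
  induction l generalizing n s with
  | nil =>
    simp only [List.nil_append, List.cons_append, prefixProb]
    split_ifs with h
    · rw [nextStep_apply, tsum_eq_single q.1]
      · simp [strat, PMF.tsum_coe]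
      · intro s' h'
        rw [if_neg (Ne.symm h'), mul_zero]
    · simp
  | cons r l ih =>
    simp only [List.cons_append, prefixProb]
    split_ifs with h
    · rw [mul_assoc, ← ENNReal.tsum_mul_right]
      refine congrArg _ (tsum_congr fun s' => ?_)
      rw [mul_assoc]
      exact congrArg _ (ih _ _)
    · simp

theorem playLaw_eq (𝓜 : A.Machine) (n : 𝓜.N) (s : A.State) :
    𝓜.playLaw n s = Kernel.trajMeasure (X := fun _ => A.Step)
      (A.firstStep (𝓜.strat n) s).toMeasure (A.stepKernel (𝓜.strat n)) := by
  simp only [playLaw, playDist, joint_self]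

theorem playLaw_prefixSet (𝓜 : A.Machine) (n : 𝓜.N) (s : A.State) (l : List A.Step) :
    𝓜.playLaw n s (prefixSet l) = 𝓜.prefixProb n s l := by
  induction l using List.reverseRecOn with
  | nil => simp [prefixSet, prefixProb]
  | append_singleton l q ih =>
    rcases List.eq_nil_or_concat l with rfl | ⟨l, p, rfl⟩
    · rw [List.nil_append, prefixProb_singleton, playLaw_eq, trajMeasure_prefixSet_singleton,
        PMF.toMeasure_apply_singleton _ _ MeasurableSet.of_discrete]
    · rw [List.concat_eq_append] at ih ⊢
      rw [prefixProb_snoc, ← ih, playLaw_eq, trajMeasure_prefixSet_append]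
      congr 1
      rw [stepKernel]
      have h0 : ∀ (k : ℕ) (f : ((_ : Finset.Iic k) → A.Step) → Measure A.Step) x,
          Kernel.ofFunOfCountable f x = f x := fun _ _ _ => rfl
      rw [h0]
      rw [PMF.toMeasure_apply_singleton _ _ MeasurableSet.of_discrete]
      have h1 : (List.ofFn fun i : Fin (l.length + 1) => (l ++ [p])[(i : ℕ)]'(by simp; omega)) =
          l ++ [p] := by
        refine List.ext_getElem (by simp) fun i h1 h2 => ?_
        simp only [List.getElem_ofFn]
      rw [h1]
      simp

/-! ### One-step decompositions -/

/-- Put an element in front of a sequence. -/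
def _root_.consSeq {D : Type*} (p : D) (x : ℕ → D) : ℕ → D
  | 0 => p
  | i + 1 => x i

theorem _root_.measurable_consSeq {D : Type*} [MeasurableSpace D] (p : D) :
    Measurable (consSeq p) := by
  refine measurable_pi_lambda _ fun i => ?_
  cases i with
  | zero => exact measurable_const
  | succ i => exact measurable_pi_apply i

theorem colWord_consSeq (p : A.Step) (x : ℕ → A.Step) :
    A.colWord (consSeq p x) = prepend [A.col p.1 p.2] (A.colWord x) := by
  funext i
  cases i with
  | zero => simp [colWord, consSeq, prepend]
  | succ i => simp [colWord, consSeq, prepend]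

theorem _root_.consSeq_preimage_prefixSet_cons {D : Type*} [DecidableEq D] (p q : D)
    (l : List D) : consSeq p ⁻¹' prefixSet (q :: l) = if q = p then prefixSet l else ∅ := by
  rw [← ite_congr (propext eq_comm) (fun _ => rfl) (fun _ => rfl)]
  refine Eq.trans ?_ (prepend_singleton_preimage_cons p q l)
  ext x
  change consSeq p x ∈ prefixSet _ ↔ prepend [p] x ∈ prefixSet _
  have : consSeq p x = prepend [p] x := by
    funext i
    cases i <;> simp [consSeq, prepend]
  rw [this]
  rfl

/-- The kernels depend on the whole past, so the first step cannot be split off directly. Both sides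
are compared on prefixes, where the recursion of `prefixProb` does it. -/
theorem playLaw_eq_sum (𝓜 : A.Machine) (n : 𝓜.N) (s : A.State) :
    𝓜.playLaw n s = Measure.sum fun a => 𝓜.nxt s n a • Measure.sum fun s' => A.trans s a s' •
      (𝓜.playLaw (𝓜.upd n (A.step s a)) s').map
        (consSeq (A.step s a)) := by
  classical
  refine measure_ext_prefixSet fun l => ?_
  have hl := measurableSet_prefixSet l
  simp only [Measure.sum_apply _ hl, Measure.smul_apply, smul_eq_mul,
    Measure.map_apply (measurable_consSeq _) hl, playLaw_prefixSet]
  cases l with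
  | nil => 
    have : ∀ p : A.Step, consSeq p ⁻¹' prefixSet [] = Set.univ := by
      intro p; ext x; simp [prefixSet]
    simp [this, prefixProb, PMF.tsum_coe]
  | cons q l =>
    simp only [consSeq_preimage_prefixSet_cons, prefixProb]
    split_ifs with h
    · subst h
      rw [tsum_eq_single q.2]
      · refine congrArg _ (tsum_congr fun s' => ?_)
        rw [if_pos (show q = A.step q.1 q.2 from rfl), playLaw_prefixSet]
        rfl
      · intro a ha
        have : q ≠ A.step q.1 a := fun h => ha (eq_step_iff.1 h).2.symm
        simp [this]
    · symm
      refine ENNReal.tsum_eq_zero.2 fun a => ?_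
      have : q ≠ A.step s a := fun h' => h (eq_step_iff.1 h').1
      simp [this]

/-- The interface to the measure on plays: later comparisons of laws of machines start from this
equation. -/
theorem law_apply (𝓜 : A.Machine) (n : 𝓜.N) (s : A.State) {E : Set (Words C)}
    (hE : MeasurableSet E) :
    (𝓜.law n s : Measure (Words C)) E = ∑' a, 𝓜.nxt s n a * ∑' s', A.trans s a s' *
      (𝓜.law (𝓜.upd n (A.step s a)) s' : Measure (Words C)) (prepend [A.col s a] ⁻¹' E) := by
  have hE' := A.measurable_colWord hE
  rw [coe_law, Measure.map_apply A.measurable_colWord hE, playLaw_eq_sum]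
  simp only [Measure.sum_apply _ hE', Measure.smul_apply, smul_eq_mul,
    Measure.map_apply (measurable_consSeq _) hE']
  refine tsum_congr fun a => congrArg _ (tsum_congr fun s' => congrArg _ ?_)
  rw [coe_law, Measure.map_apply A.measurable_colWord (measurable_prepend _ hE)]
  congr 1
  ext x
  simp only [Set.mem_preimage, colWord_consSeq, step_fst, step_snd]

/-- Two machines that can be kept related step by step have the same laws. -/
theorem law_eq_of_related {A B : Arena C} (𝓐 : A.Machine) (𝓑 : B.Machine)
    (R : 𝓑.N → B.State → 𝓐.N → A.State → Prop)
    (hR : ∀ n s n' s', R n s n' s' → ∃ k : A.Act → B.Act, 𝓑.nxt s n = (𝓐.nxt s' n').map k ∧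
      ∀ x ∈ (𝓐.nxt s' n').support, B.col s (k x) = A.col s' x ∧
        ∃ g : B.State → A.State, A.trans s' x = (B.trans s (k x)).map g ∧
          ∀ r ∈ (B.trans s (k x)).support, R (𝓑.upd n (B.step s (k x))) r (𝓐.upd n' (A.step s' x)) (g r))
    {n : 𝓑.N} {s : B.State} {n' : 𝓐.N} {s' : A.State} (h : R n s n' s') :
    𝓑.law n s = 𝓐.law n' s' := by
  classical
  refine probabilityMeasure_ext_wordCyl fun u => ?_
  -- A cylinder only concerns as many steps as its word has letters, so an invariant preserved by
  -- each step suffices.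
  induction u generalizing n s n' s' with
  | nil => simp
  | cons c u ih =>
    obtain ⟨k, hk, hx⟩ := hR n s n' s' h
    rw [law_apply _ _ _ (measurableSet_wordCyl _), law_apply _ _ _ (measurableSet_wordCyl _),
      hk, PMF.tsum_map_mul]
    refine PMF.tsum_congr_support _ fun x hxs => ?_
    obtain ⟨hc, g, hg, hr⟩ := hx x hxs
    rw [hg, PMF.tsum_map_mul]
    refine PMF.tsum_congr_support _ fun r hrs => ?_
    rw [hc, prepend_singleton_preimage_cons]
    split_ifs
    · exact ih (hr r hrs)
    · simp

end Machine
end Arena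

/-! ### Strategies of a given type as machines -/

/-- Types of pure strategies. -/
def StratType.IsPure (X : StratType) : Prop := X = .pureFM ∨ X = .pure

/-- Types of finite-memory strategies. -/
def StratType.IsFin (X : StratType) : Prop := X = .pureFM ∨ X = .randFM

theorem PMF.support_eq_singleton_iff {α : Type*} {p : PMF α} {a : α} :
    p.support = {a} ↔ p = PMF.pure a := by
  constructor
  · intro h
    ext b
    by_cases hb : b = a
    · subst hb
      rw [(PMF.apply_eq_one_iff p b).2 h]
      simp
    · have : b ∉ p.support := by rw [h]; exact hb
      rw [(PMF.apply_eq_zero_iff p b).2 this]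
      simp [hb]
  · rintro rfl
    simp

theorem Preference.refl {C : Type*} (pref : Preference C) (μ) : pref.rel μ μ :=
  (pref.total μ μ).elim id id

theorem MemorySkeleton.run_append {C : Type*} (M : MemorySkeleton C) (m : M.Mem)
    (v w : List C) : M.run m (v ++ w) = M.run (M.run m v) w := List.foldl_append

namespace Arena

variable {C : Type*} {A : Arena C}

/-- One description for the four types, so that later proofs need no case distinction on `X`. -/
theorem mem_strats_iff {X : StratType} {I : Set A.State} {i : Player} {σ : A.Strat} :
    σ ∈ A.strats X I i ↔ A.IsStrat I i σ ∧ (X.IsPure → A.IsPure I i σ) ∧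
      (X.IsFin → A.IsFiniteMemory I i σ) := by
  cases X <;> simp [strats, StratType.IsPure, StratType.IsFin]

theorem IsHist.mono {I J : Set A.State} (hIJ : I ⊆ J) {l : List A.Step} {s : A.State}
    (h : A.IsHist I l s) : A.IsHist J l s := by
  induction h with
  | nil h => exact .nil (hIJ h)
  | snoc _ ha hs ih => exact .snoc ih ha hs

theorem IsHist.snoc_step {I : Set A.State} {l : List A.Step} {s s' : A.State} {a : A.Act}
    (h : A.IsHist I l s) (ha : a ∈ A.avail s) (hs : s' ∈ (A.trans s a).support) :
    A.IsHist I (l ++ [A.step s a]) s' := .snoc h ha hs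

theorem strats_mono {X : StratType} {I J : Set A.State} (hIJ : I ⊆ J) {i : Player} :
    A.strats X J i ⊆ A.strats X I i := by
  intro σ h
  rw [mem_strats_iff] at h ⊢
  refine ⟨fun l s hl => h.1 l s (hl.mono hIJ), fun hX l s hl => h.2.1 hX l s (hl.mono hIJ),
    fun hX => ?_⟩
  obtain ⟨N, hN, n₀, upd, nxt, h1, h2⟩ := h.2.2 hX
  exact ⟨N, hN, n₀, upd, nxt, h1, fun l s hl => h2 l s (hl.mono hIJ)⟩

/-- Some available action. -/
def someAct (A : Arena C) (s : A.State) : A.Act := (A.avail_nonempty s).choose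

theorem someAct_mem (s : A.State) : A.someAct s ∈ A.avail s := (A.avail_nonempty s).choose_spec

theorem support_pure_someAct (s : A.State) : (PMF.pure (A.someAct s)).support ⊆ A.avail s := by
  simpa using someAct_mem s

namespace Machine

/-- The machines that implement strategies of type `X` for both players. -/
structure Ok (X : StratType) (𝓜 : A.Machine) : Prop where
  avail : ∀ s n, (𝓜.nxt s n).support ⊆ A.avail s
  pure : X.IsPure → ∀ s n, ∃ a, 𝓜.nxt s n = PMF.pure a
  fin : X.IsFin → Finite 𝓜.N

theorem Ok.strat_mem {X : StratType} {𝓜 : A.Machine} (h : 𝓜.Ok X) (n : 𝓜.N) (I : Set A.State)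
    (i : Player) : 𝓜.strat n ∈ A.strats X I i := by
  rw [mem_strats_iff]
  refine ⟨fun l s _ _ => h.avail s _, fun hX l s _ _ => ?_, fun hX => ?_⟩
  · obtain ⟨a, ha⟩ := h.pure hX s (l.foldl 𝓜.upd n)
    exact ⟨a, PMF.support_eq_singleton_iff.2 ha⟩
  · exact ⟨𝓜.N, h.fin hX, n, 𝓜.upd, 𝓜.nxt, fun s n _ => h.avail s n, fun _ _ _ _ => rfl⟩

-- Strategies are constrained on actual histories only, machines of type `X` everywhere. Choices
-- that violate a constraint are replaced by a default action; no history meets them.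
open Classical in
theorem exists_ok_of_strat {X : StratType} {I : Set A.State} {σ : A.Strat}
    (hs : ∀ l s, A.IsHist I l s → (σ l s).support ⊆ A.avail s)
    (hp : X.IsPure → ∀ l s, A.IsHist I l s → ∃ a, σ l s = PMF.pure a)
    (N : Type) (hN : X.IsFin → Finite N) (n₀ : N) (upd : N → A.Step → N)
    (nxt : A.State → N → PMF A.Act)
    (h : ∀ l s, A.IsHist I l s → σ l s = nxt s (l.foldl upd n₀)) :
    ∃ nxt', (Machine.mk N upd nxt').Ok X ∧
      ∀ l s, A.IsHist I l s → (Machine.mk N upd nxt').strat n₀ l s = σ l s := by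
  refine ⟨fun s n => if (nxt s n).support ⊆ A.avail s ∧ (X.IsPure → ∃ a, nxt s n = PMF.pure a)
    then nxt s n else PMF.pure (A.someAct s), ⟨fun s n => ?_, fun hX s n => ?_, hN⟩, ?_⟩
  · dsimp only
    split_ifs with h
    · exact h.1
    · exact support_pure_someAct s
  · dsimp only
    split_ifs with h
    · exact h.2 hX
    · exact ⟨_, rfl⟩
  · intro l s hl
    dsimp only [strat]
    rw [← h l s hl, if_pos ⟨hs l s hl, fun hX => hp hX l s hl⟩]

/-- The machine that remembers the whole history. -/
def ofStrat (σ : A.Strat) : A.Machine where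
  N := List A.Step
  upd l p := l ++ [p]
  nxt s l := σ l s

theorem foldl_concat {D : Type*} (l l' : List D) :
    l'.foldl (fun l p => l ++ [p]) l = l ++ l' := by
  induction l' generalizing l with
  | nil => simp
  | cons p l' ih => rw [List.foldl_cons, ih]; simp

theorem ofStrat_strat (σ : A.Strat) : (ofStrat σ).strat [] = σ := by
  funext l s
  change σ (l.foldl (fun l p => l ++ [p]) []) s = σ l s
  rw [foldl_concat, List.nil_append]

theorem colDist_joint (σ₁ σ₂ : A.Strat) (s : A.State) :
    A.colDist s (A.joint σ₁ σ₂) (A.joint σ₁ σ₂) = A.colDist s σ₁ σ₂ := by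
  apply Subtype.ext
  change (A.playDist _ _ _).map _ = (A.playDist _ _ _).map _
  simp only [playDist, joint_self]

theorem colDist_eq_law (𝓜 : A.Machine) (n : 𝓜.N) (s : A.State) (σ₁ σ₂ : A.Strat)
    (ha : ∀ l r, A.IsHist {s} l r → (A.joint σ₁ σ₂ l r).support ⊆ A.avail r)
    (h : ∀ l r, A.IsHist {s} l r → A.joint σ₁ σ₂ l r = 𝓜.strat n l r) :
    A.colDist s σ₁ σ₂ = 𝓜.law n s := by
  rw [← colDist_joint, ← ofStrat_strat (A.joint σ₁ σ₂)]
  -- The history-remembering machine is related to `𝓜` as long as its memory is a genuine history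
  -- and `𝓜` is in the state reached by reading it.
  refine law_eq_of_related 𝓜 (ofStrat (A.joint σ₁ σ₂))
    (fun l r n' r' => r = r' ∧ A.IsHist {s} l r ∧ n' = l.foldl 𝓜.upd n) ?_ ⟨rfl, .nil rfl, rfl⟩
  rintro l r n' _ ⟨rfl, hl, rfl⟩
  refine ⟨id, ?_, fun x hx => ⟨rfl, id, (PMF.map_id _).symm, fun q hq => ⟨rfl, ?_, ?_⟩⟩⟩
  · rw [PMF.map_id]
    exact h l r hl
  · have hx' : x ∈ (A.joint σ₁ σ₂ l r).support := by rw [h l r hl]; exact hx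
    exact hl.snoc_step (ha l r hl hx') hq
  · exact (List.foldl_append (l := l) (l' := [A.step r x])).symm

theorem joint_support {X : StratType} {I : Set A.State} {σ₁ σ₂ : A.Strat}
    (h₁ : σ₁ ∈ A.strats X I .one) (h₂ : σ₂ ∈ A.strats X I .two) {l : List A.Step}
    {s : A.State} (hl : A.IsHist I l s) : (A.joint σ₁ σ₂ l s).support ⊆ A.avail s := by
  unfold joint
  cases ho : A.owner s
  · exact h₁.1 l s hl ho
  · exact h₂.1 l s hl ho

/-- Two strategies of type `X` are implemented by one machine. -/
theorem exists_ok_of_strats {X : StratType} {I : Set A.State} {σ₁ σ₂ : A.Strat}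
    (h₁ : σ₁ ∈ A.strats X I .one) (h₂ : σ₂ ∈ A.strats X I .two) :
    ∃ (𝓜 : A.Machine) (n : 𝓜.N), 𝓜.Ok X ∧ ∀ s ∈ I, A.colDist s σ₁ σ₂ = 𝓜.law n s := by
  have hs : ∀ l s, A.IsHist I l s → (A.joint σ₁ σ₂ l s).support ⊆ A.avail s :=
    fun l s hl => joint_support h₁ h₂ hl
  rw [mem_strats_iff] at h₁ h₂
  have hp : X.IsPure → ∀ l s, A.IsHist I l s → ∃ a, A.joint σ₁ σ₂ l s = PMF.pure a := by
    intro hX l s hl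
    unfold joint
    cases ho : A.owner s
    · obtain ⟨a, ha⟩ := h₁.2.1 hX l s hl ho
      exact ⟨a, PMF.support_eq_singleton_iff.1 ha⟩
    · obtain ⟨a, ha⟩ := h₂.2.1 hX l s hl ho
      exact ⟨a, PMF.support_eq_singleton_iff.1 ha⟩
  have key : ∃ (N : Type) (_ : X.IsFin → Finite N) (n₀ : N) (upd : N → A.Step → N)
      (nxt : A.State → N → PMF A.Act),
      ∀ l s, A.IsHist I l s → A.joint σ₁ σ₂ l s = nxt s (l.foldl upd n₀) := by
    by_cases hX : X.IsFin
    · obtain ⟨N₁, _, n₁, upd₁, nxt₁, -, e₁⟩ := h₁.2.2 hX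
      obtain ⟨N₂, _, n₂, upd₂, nxt₂, -, e₂⟩ := h₂.2.2 hX
      -- The two finite memories run in parallel, each reading all steps.
      refine ⟨N₁ × N₂, fun _ => inferInstance, (n₁, n₂),
        fun n p => (upd₁ n.1 p, upd₂ n.2 p), fun s n => match A.owner s with
          | .one => nxt₁ s n.1
          | .two => nxt₂ s n.2, fun l s hl => ?_⟩
      have hfold : ∀ (l : List A.Step) (n : N₁ × N₂),
          l.foldl (fun n p => (upd₁ n.1 p, upd₂ n.2 p)) n =
            (l.foldl upd₁ n.1, l.foldl upd₂ n.2) := by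
        intro l
        induction l with
        | nil => intro n; rfl
        | cons p l ih => intro n; rw [List.foldl_cons, ih]; rfl
      rw [hfold]
      unfold joint
      dsimp only
      cases ho : A.owner s
      · exact e₁ l s hl ho
      · exact e₂ l s hl ho
    -- Without a bound on memory, the history itself serves as memory state.
    · refine ⟨List A.Step, fun h => (hX h).elim, [], fun l p => l ++ [p],
        fun s l => A.joint σ₁ σ₂ l s, fun l s _ => ?_⟩
      rw [foldl_concat, List.nil_append]
  obtain ⟨N, hN, n₀, upd, nxt, h⟩ := key
  obtain ⟨nxt', hok, h'⟩ := exists_ok_of_strat hs hp N hN n₀ upd nxt h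
  refine ⟨_, n₀, hok, fun s hsI => colDist_eq_law _ _ _ _ _ ?_ ?_⟩
  · exact fun l r hl => hs l r (hl.mono (Set.singleton_subset_iff.2 hsI))
  · exact fun l r hl => (h' l r (hl.mono (Set.singleton_subset_iff.2 hsI))).symm

end Machine

open Machine

theorem mem_cols_iff {X : StratType} {s : A.State} {μ : ProbabilityMeasure (Words C)} :
    μ ∈ A.cols X s ↔ ∃ (𝓜 : A.Machine) (n : 𝓜.N), 𝓜.Ok X ∧ μ = 𝓜.law n s := by
  constructor
  · rintro ⟨σ₁, h₁, σ₂, h₂, rfl⟩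
    obtain ⟨𝓜, n, hok, h⟩ := exists_ok_of_strats h₁ h₂
    exact ⟨𝓜, n, hok, h s rfl⟩
  · rintro ⟨𝓜, n, hok, rfl⟩
    exact ⟨_, hok.strat_mem n _ _, _, hok.strat_mem n _ _, rfl⟩

theorem Machine.Ok.law_mem_cols {X : StratType} {𝓜 : A.Machine} (h : 𝓜.Ok X) (n : 𝓜.N)
    (s : A.State) : 𝓜.law n s ∈ A.cols X s := mem_cols_iff.2 ⟨𝓜, n, h, rfl⟩

/-- In one-player arenas the strategy of player 2 does not matter. -/
theorem OnePlayer.colDist_congr (hA : A.OnePlayer) {X : StratType} {s : A.State}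
    {σ₁ σ₂ σ₂' : A.Strat} (h₁ : σ₁ ∈ A.strats X {s} .one) (h₂ : σ₂ ∈ A.strats X {s} .two)
    (h₂' : σ₂' ∈ A.strats X {s} .two) : A.colDist s σ₁ σ₂ = A.colDist s σ₁ σ₂' := by
  rw [← colDist_joint σ₁ σ₂', ← ofStrat_strat (A.joint σ₁ σ₂')]
  refine colDist_eq_law _ _ _ _ _ (fun l r hl => joint_support h₁ h₂ hl) fun l r hl => ?_
  rw [ofStrat_strat]
  unfold joint
  cases ho : A.owner r
  · rfl
  · obtain ⟨a, ha⟩ := hA r ho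
    have h : ∀ σ ∈ A.strats X {s} .two, σ l r = PMF.pure a := fun σ hσ =>
      PMF.support_eq_singleton_iff.1 ((Set.Nonempty.subset_singleton_iff
        (PMF.support_nonempty _)).1 ((hσ.1 l r hl ho).trans ha.subset))
    exact (h _ h₂).trans (h _ h₂').symm

/-- The law of `σ` lies in its own upward closure by reflexivity. Optimality puts it in the upward
closure of any competitor, whose law does not depend on player 2. -/
theorem IsOptimal.exists_machine (hA : A.OnePlayer) {pref : Preference C} {X : StratType}
    {I : Set A.State} {σ σ₂ : A.Strat} (h : A.IsOptimal pref X I σ)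
    (h₂ : σ₂ ∈ A.strats X I .two) {s : A.State} (hs : s ∈ I) {μ : ProbabilityMeasure (Words C)}
    (hμ : μ ∈ A.cols X s) : pref.rel μ (A.colDist s σ σ₂) := by
  obtain ⟨𝓜, n, hok, rfl⟩ := mem_cols_iff.1 hμ
  have hsI := Set.singleton_subset_iff.2 hs
  obtain ⟨σ₂', h₂', hrel⟩ := h.2 (𝓜.strat n) (hok.strat_mem n _ _) s hs
    ⟨σ₂, strats_mono hsI h₂, pref.refl _⟩
  rwa [hA.colDist_congr (hok.strat_mem n _ _) h₂' (hok.strat_mem n _ _)] at hrel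

theorem Machine.Ok.isOptimal (hA : A.OnePlayer) {pref : Preference C} {X : StratType}
    {I : Set A.State} {𝓜 : A.Machine} (hok : 𝓜.Ok X) {n : 𝓜.N}
    (h : ∀ s ∈ I, ∀ μ ∈ A.cols X s, pref.rel μ (𝓜.law n s)) :
    A.IsOptimal pref X I (𝓜.strat n) := by
  refine ⟨hok.strat_mem n _ _, fun σ' hσ' s hs => ?_⟩
  rintro μ ⟨σ₂, h₂, hrel⟩
  have hσ := hok.strat_mem n {s}
  refine ⟨𝓜.strat n, hσ _, pref.trans _ _ _ (h s hs _ ?_) ?_⟩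
  · exact ⟨σ', strats_mono (Set.singleton_subset_iff.2 hs) hσ', _, hσ _, rfl⟩
  · rwa [hA.colDist_congr (hσ _) h₂ (hσ _)] at hrel

end Arena

/-- In an arena only finitely many memory states are reachable. -/
theorem MemorySkeleton.exists_finite_memory {C : Type*} (M : MemorySkeleton C) (A : Arena C) :
    ∃ (k : ℕ) (val : Fin k → M.Mem) (j₀ : Fin k) (upd : Fin k → A.Step → Fin k),
      Function.Injective val ∧ val j₀ = M.init ∧
        ∀ j p, val (upd j p) = M.upd (val j) (A.col p.1 p.2) := by
  have hB : (Set.range fun p : A.Step => A.col p.1 p.2).Finite := Set.finite_range _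
  set R := {m | ∃ w : List C, (∀ c ∈ w, c ∈ Set.range fun p : A.Step => A.col p.1 p.2) ∧
    w.foldl M.upd M.init = m} with hR
  have hfin : Finite R := M.finite_reach _ hB
  -- The skeleton may live in any universe, machine memories are in `Type`: hence the renumbering by
  -- `Fin k`.
  obtain ⟨k, ⟨e⟩⟩ := Finite.exists_equiv_fin R
  have hupd : ∀ (m : R) (p : A.Step), M.upd m (A.col p.1 p.2) ∈ R := by
    rintro ⟨_, w, hw, rfl⟩ p
    refine ⟨w ++ [A.col p.1 p.2], ?_, by simp⟩
    intro c hc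
    rcases List.mem_append.1 hc with hc | hc
    · exact hw c hc
    · rw [List.mem_singleton.1 hc]
      exact ⟨p, rfl⟩
  refine ⟨k, fun j => (e.symm j : M.Mem), e ⟨M.init, [], by simp, rfl⟩,
    fun j p => e ⟨_, hupd (e.symm j) p⟩, Subtype.val_injective.comp e.symm.injective, ?_, ?_⟩
  · simp
  · intro j p
    simp

/-! ### Payoff functions -/

theorem integralPos_mix {C : Type*} {I : Type} [Countable I] (f : Words C → ℝ) (lam : I → ℝ≥0)
    (hlam : ∑' i, (lam i : ℝ≥0∞) = 1) (μ : I → ProbabilityMeasure (Words C)) :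
    integralPos f (mix lam hlam μ) = ∑' i, (lam i : ℝ≥0∞) * integralPos f (μ i) := by
  unfold integralPos mix
  rw [ProbabilityMeasure.coe_mk, lintegral_sum_measure]
  simp only [lintegral_smul_measure, smul_eq_mul]

/-- Clearing the subtractions leaves sums in `[0, ∞]`, which weighted countable sums respect even at
infinity. -/
theorem EReal.sub_le_sub_iff_of_ennreal {P N P' N' : ℝ≥0∞} (h : P ≠ ⊤ ∨ N ≠ ⊤)
    (h' : P' ≠ ⊤ ∨ N' ≠ ⊤) :
    (P : EReal) - N ≤ (P' : EReal) - N' ↔ P + N' ≤ P' + N := by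
  induction P <;> induction N <;> induction P' <;> induction N' <;> simp at h h' ⊢
  all_goals have e : ∀ x : ℝ≥0, ((x : ℝ≥0∞) : EReal) = ((x : ℝ) : EReal) := fun _ => rfl
  case coe.coe.coe.coe P N P' N' =>
    rw [e, e, e, e, ← EReal.coe_sub, ← EReal.coe_sub, EReal.coe_le_coe_iff]
    norm_cast
    rw [sub_le_sub_iff]
    norm_cast
  all_goals
    rw [e, e, ← EReal.coe_sub]
    simp only [EReal.coe_ne_top, EReal.coe_ne_bot, not_false_eq_true]

theorem mixingUseless_payoffPreference {C : Type*} {f : Words C → ℝ}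
    (hw : ExpectationWellDefined f) : MixingUseless (payoffPreference f) := by
  intro I _ lam _ hlam μ μ' h
  change expectation f _ ≤ expectation f _
  unfold expectation
  rw [EReal.sub_le_sub_iff_of_ennreal (hw _) (hw _)]
  simp only [integralPos_mix, ← ENNReal.tsum_add, ← mul_add]
  refine ENNReal.tsum_le_tsum fun i => mul_le_mul_right ?_ _
  exact (EReal.sub_le_sub_iff_of_ennreal (hw _) (hw _)).1 (h i)

/-! ### Countable mixtures -/

theorem ENNReal.tsum_option {α : Type*} (F : Option α → ℝ≥0∞) :
    ∑' x, F x = F none + ∑' a, F (some a) := by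
  classical
  rw [ENNReal.tsum_eq_add_tsum_ite none]
  congr 1
  rw [← (Option.some_injective α).tsum_eq]
  · exact tsum_congr fun a => if_neg (by simp)
  · rintro (_ | a) h
    · simp at h
    · exact ⟨a, rfl⟩

theorem ENNReal.tsum_list {α : Type*} (F : List α → ℝ≥0∞) :
    ∑' x, F x = F [] + ∑' a, ∑' x, F (a :: x) := by
  let e : Option (α × List α) ≃ List α :=
    { toFun := fun o => o.elim [] fun p => p.1 :: p.2
      invFun := fun l => match l with
        | [] => none
        | a :: l => some (a, l)
      left_inv := by rintro (_ | ⟨a, l⟩) <;> rfl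
      right_inv := by rintro (_ | ⟨a, l⟩) <;> rfl }
  rw [← e.tsum_eq, ENNReal.tsum_option, ENNReal.tsum_prod']
  rfl

/-- The index `none` is reserved for the remainder of a decomposition. If the other weights are all
0 or 1, total mass 1 makes the mixture a single component, and no property of mixing is needed. -/
theorem Preference.rel_of_sum_eq {C : Type*} (pref : Preference C) {J : Type} [Countable J]
    {lam : Option J → ℝ≥0∞}
    (h : MixingUseless pref ∨ ∀ j, lam (some j) = 0 ∨ lam (some j) = 1)
    {μ μ' : Option J → ProbabilityMeasure (Words C)} {ν ν' : ProbabilityMeasure (Words C)}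
    (hν : (ν : Measure (Words C)) = Measure.sum fun i => lam i • (μ i : Measure (Words C)))
    (hν' : (ν' : Measure (Words C)) = Measure.sum fun i => lam i • (μ' i : Measure (Words C)))
    (hrel : ∀ i, lam i ≠ 0 → pref.rel (μ i) (μ' i)) : pref.rel ν ν' := by
  have hsum : ∑' i, lam i = 1 := by
    have := congrArg (fun m : Measure (Words C) => m Set.univ) hν
    simpa [Measure.sum_apply _ MeasurableSet.univ] using this.symm
  have hfin : ∀ i, lam i ≠ ⊤ := fun i =>
    ((ENNReal.le_tsum i).trans hsum.le).trans_lt ENNReal.one_lt_top |>.ne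
  rcases h with h | h
  -- Useless mixing is about positive weights, so the null ones are dropped.
  · let I := {i // lam i ≠ 0}
    have hcoe : ∀ i : I, (((lam i).toNNReal : ℝ≥0) : ℝ≥0∞) = lam i :=
      fun i => ENNReal.coe_toNNReal (hfin i)
    have hsub : ∀ F : Option J → ℝ≥0∞, ∑' i : I, lam i * F i = ∑' i, lam i * F i := by
      intro F
      refine tsum_subtype_eq_of_support_subset (s := {i | lam i ≠ 0})
        (f := fun i => lam i * F i) ?_
      intro i hi h0
      exact hi (by simp [h0])
    have hone : ∑' i : I, (((lam i).toNNReal : ℝ≥0) : ℝ≥0∞) = 1 := by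
      simp only [hcoe]
      simpa [hsum] using hsub fun _ => 1
    have hmix : ∀ (ν : ProbabilityMeasure (Words C)) (μ : Option J → ProbabilityMeasure (Words C)),
        (ν : Measure (Words C)) = Measure.sum (fun i => lam i • (μ i : Measure (Words C))) →
        ν = mix (fun i : I => (lam i).toNNReal) hone fun i => μ i := by
      intro ν μ hν
      refine Subtype.ext (hν.trans ?_)
      ext E hE
      simp only [mix, Measure.sum_apply _ hE, Measure.smul_apply, hcoe,
        smul_eq_mul]
      exact (hsub fun i => (μ i : Measure (Words C)) E).symm
    rw [hmix ν μ hν, hmix ν' μ' hν']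
    exact h I _ (fun i => ENNReal.toNNReal_pos i.2 (hfin i)) hone _ _ fun i => hrel i i.2
  · have key : ∃ i, lam i = 1 := by
      by_contra hne
      push Not at hne
      -- If no path carries the full mass, none carries any, and the remainder has weight 1.
      have h0 : ∀ j, lam (some j) = 0 := fun j => (h j).resolve_right (hne _)
      refine hne none ?_
      rw [← hsum, tsum_eq_single none]
      rintro (_ | j) hj
      · exact (hj rfl).elim
      · exact h0 j
    obtain ⟨i, hi⟩ := key
    have h0 : ∀ j, j ≠ i → lam j = 0 := by
      classical
      intro j hj
      have := ENNReal.sum_le_tsum (f := lam) {i, j}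
      rw [Finset.sum_pair hj.symm, hsum, hi] at this
      have h2 : (1 : ℝ≥0∞) + lam j ≤ 1 + 0 := by simpa using this
      simpa using (ENNReal.add_le_add_iff_left ENNReal.one_ne_top).1 h2
    have hdirac : ∀ (ν : ProbabilityMeasure (Words C)) (μ : Option J → ProbabilityMeasure (Words C)),
        (ν : Measure (Words C)) = Measure.sum (fun i => lam i • (μ i : Measure (Words C))) →
        ν = μ i := by
      intro ν μ hν
      refine Subtype.ext (hν.trans ?_)
      ext E hE
      rw [Measure.sum_apply _ hE, tsum_eq_single i]
      · simp [hi]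
      · intro j hj
        simp [h0 j hj]
    rw [hdirac ν μ hν, hdirac ν' μ' hν']
    exact hrel i (by simp [hi])

/-! ### Decomposition at the first visit to a state -/

namespace Arena.Machine

variable {C : Type*} {A : Arena C} (𝓜 : A.Machine) (t : A.State)

open Classical in
/-- The probability that the play takes the given path to its first visit to `t`. -/
def hitWt : 𝓜.N → A.State → List (A.Act × A.State) → ℝ≥0∞
  | _, s, [] => if s = t then 1 else 0
  | n, s, p :: x => if s = t then 0 else
      𝓜.nxt s n p.1 * (A.trans s p.1 p.2 * hitWt (𝓜.upd n (A.step s p.1)) p.2 x)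

/-- The memory state at the end of a path. -/
def pathMem : 𝓜.N → A.State → List (A.Act × A.State) → 𝓜.N
  | n, _, [] => n
  | n, s, p :: x => pathMem (𝓜.upd n (A.step s p.1)) p.2 x

/-- The colors of a path. -/
def _root_.Arena.pathColors (A : Arena C) : A.State → List (A.Act × A.State) → List C
  | _, [] => []
  | s, p :: x => A.col s p.1 :: pathColors A p.2 x

/-- Families of distributions that satisfy the one-step equations of the machine outside `t`. -/
def SolvesOutside (G : 𝓜.N → A.State → ProbabilityMeasure (Words C)) : Prop :=
  ∀ n s, s ≠ t → ∀ E, MeasurableSet E → (G n s : Measure (Words C)) E =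
    ∑' a, 𝓜.nxt s n a * ∑' s', A.trans s a s' *
      (G (𝓜.upd n (A.step s a)) s' : Measure (Words C)) (prepend [A.col s a] ⁻¹' E)

variable (G G' : 𝓜.N → A.State → ProbabilityMeasure (Words C))

/-- The distribution after a path to `t`. -/
def hitLaw (n : 𝓜.N) (s : A.State) (x : List (A.Act × A.State)) :
    ProbabilityMeasure (Words C) :=
  shiftDist (A.pathColors s x) (G (𝓜.pathMem n s x) t)

/-- The contribution of the paths of length at most `k`. -/
def hitSum (k : ℕ) (n : 𝓜.N) (s : A.State) (E : Set (Words C)) : ℝ≥0∞ :=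
  ∑' x : List (A.Act × A.State), if x.length ≤ k then
    𝓜.hitWt t n s x * (𝓜.hitLaw t G n s x : Measure (Words C)) E else 0

variable {t G G'}

theorem hitSum_self (k : ℕ) (n : 𝓜.N) (E : Set (Words C)) :
    𝓜.hitSum t G k n t E = (G n t : Measure (Words C)) E := by
  rw [hitSum, ENNReal.tsum_list]
  simp [hitWt, hitLaw, pathColors, shiftDist_nil, pathMem]

theorem hitSum_zero {n : 𝓜.N} {s : A.State} (hs : s ≠ t) (E : Set (Words C)) :
    𝓜.hitSum t G 0 n s E = 0 := by
  rw [hitSum, ENNReal.tsum_list]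
  simp [hitWt, hs]

theorem hitSum_succ (k : ℕ) {n : 𝓜.N} {s : A.State} (hs : s ≠ t) {E : Set (Words C)}
    (hE : MeasurableSet E) :
    𝓜.hitSum t G (k + 1) n s E = ∑' a, 𝓜.nxt s n a * ∑' s', A.trans s a s' *
      𝓜.hitSum t G k (𝓜.upd n (A.step s a)) s' (prepend [A.col s a] ⁻¹' E) := by
  rw [hitSum, ENNReal.tsum_list, ENNReal.tsum_prod']
  simp only [hitWt, hs, if_false, zero_mul, ite_self, zero_add]
  refine tsum_congr fun a => ?_
  rw [← ENNReal.tsum_mul_left]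
  refine tsum_congr fun s' => ?_
  rw [hitSum, ← ENNReal.tsum_mul_left, ← ENNReal.tsum_mul_left]
  refine tsum_congr fun x => ?_
  simp only [List.length_cons, Nat.add_le_add_iff_right]
  split_ifs
  · rw [mul_assoc, mul_assoc]
    congr 3
    rw [hitLaw, pathColors, ← List.singleton_append, shiftDist_append, coe_shiftDist,
      Measure.map_apply (measurable_prepend _) hE]
    rfl
  · simp

theorem SolvesOutside.hitSum_le (hG : 𝓜.SolvesOutside t G) (k : ℕ) (n : 𝓜.N) (s : A.State)
    {E : Set (Words C)} (hE : MeasurableSet E) :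
    𝓜.hitSum t G k n s E ≤ (G n s : Measure (Words C)) E := by
  induction k generalizing n s E with
  | zero =>
    by_cases hs : s = t
    · subst hs; rw [hitSum_self]
    · rw [hitSum_zero _ hs]; exact zero_le
  | succ k ih =>
    by_cases hs : s = t
    · subst hs; rw [hitSum_self]
    · rw [hitSum_succ _ _ hs hE, hG n s hs E hE]
      gcongr
      exact ih _ _ (measurable_prepend _ hE)

/-- The part that misses `t` does not depend on the family, which only differs from `G'` at `t`. It
is stated additively to avoid truncated subtraction. A word of length at most `k` cannot see the
paths that are longer than `k`. -/
theorem SolvesOutside.add_hitSum (hG : 𝓜.SolvesOutside t G) (hG' : 𝓜.SolvesOutside t G')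
    (k : ℕ) (n : 𝓜.N) (s : A.State) (u : List C) (hu : u.length ≤ k) :
    (G n s : Measure (Words C)) (wordCyl u) + 𝓜.hitSum t G' k n s (wordCyl u) =
      (G' n s : Measure (Words C)) (wordCyl u) + 𝓜.hitSum t G k n s (wordCyl u) := by
  classical
  induction k generalizing n s u with
  | zero =>
    by_cases hs : s = t
    · subst hs; rw [hitSum_self, hitSum_self, add_comm]
    · obtain rfl : u = [] := by simpa using hu
      rw [hitSum_zero _ hs, hitSum_zero _ hs]
      simp
  | succ k ih =>
    by_cases hs : s = t
    · subst hs; rw [hitSum_self, hitSum_self, add_comm]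
    · rw [hitSum_succ _ _ hs (measurableSet_wordCyl u), hG n s hs _ (measurableSet_wordCyl u),
        hitSum_succ _ _ hs (measurableSet_wordCyl u), hG' n s hs _ (measurableSet_wordCyl u)]
      simp only [← ENNReal.tsum_add, ← mul_add]
      refine tsum_congr fun a => congrArg _ (tsum_congr fun s' => congrArg _ ?_)
      cases u with
      | nil => simpa using ih _ s' [] (by simp)
      | cons d u =>
        rw [prepend_singleton_preimage_cons]
        split_ifs
        · exact ih _ s' u (by simpa using hu)
        · simp [hitSum]

theorem hitSum_mono (n : 𝓜.N) (s : A.State) (E : Set (Words C)) :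
    Monotone fun k => 𝓜.hitSum t G k n s E := by
  intro k k' hk
  refine ENNReal.tsum_le_tsum fun x => ?_
  split_ifs with h h'
  · exact le_rfl
  · exact (h' (h.trans hk)).elim
  · exact zero_le
  · exact le_rfl

variable (t G) in
/-- The part of the distribution in which `t` is visited. -/
def hitMeasure (n : 𝓜.N) (s : A.State) : Measure (Words C) :=
  Measure.sum fun x => 𝓜.hitWt t n s x • (𝓜.hitLaw t G n s x : Measure (Words C))

theorem iSup_hitSum (n : 𝓜.N) (s : A.State) {E : Set (Words C)} (hE : MeasurableSet E) :
    ⨆ k, 𝓜.hitSum t G k n s E = 𝓜.hitMeasure t G n s E := by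
  simp only [hitMeasure, Measure.sum_apply _ hE, Measure.smul_apply, smul_eq_mul]
  apply le_antisymm
  · refine iSup_le fun k => ENNReal.tsum_le_tsum fun x => ?_
    split_ifs
    · exact le_rfl
    · exact zero_le
  · rw [ENNReal.tsum_eq_iSup_sum]
    refine iSup_le fun S => le_iSup_of_le (S.sup List.length) ?_
    refine le_trans ?_ (ENNReal.sum_le_tsum S)
    refine Finset.sum_le_sum fun x hx => ?_
    rw [if_pos (Finset.le_sup (f := List.length) hx)]

theorem SolvesOutside.hitMeasure_le (hG : 𝓜.SolvesOutside t G) (n : 𝓜.N) (s : A.State) :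
    𝓜.hitMeasure t G n s ≤ (G n s : Measure (Words C)) := by
  refine Measure.le_iff.2 fun E hE => ?_
  rw [← iSup_hitSum _ _ _ hE]
  exact iSup_le fun k => hG.hitSum_le _ k n s hE

theorem SolvesOutside.add_hitMeasure (hG : 𝓜.SolvesOutside t G) (hG' : 𝓜.SolvesOutside t G')
    (n : 𝓜.N) (s : A.State) (u : List C) :
    (G n s : Measure (Words C)) (wordCyl u) + 𝓜.hitMeasure t G' n s (wordCyl u) =
      (G' n s : Measure (Words C)) (wordCyl u) + 𝓜.hitMeasure t G n s (wordCyl u) := by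
  have hlim : ∀ H : 𝓜.N → A.State → ProbabilityMeasure (Words C),
      Filter.Tendsto (fun k => 𝓜.hitSum t H k n s (wordCyl u)) Filter.atTop
        (nhds (𝓜.hitMeasure t H n s (wordCyl u))) := by
    intro H
    rw [← iSup_hitSum _ _ _ (measurableSet_wordCyl u)]
    exact tendsto_atTop_iSup (hitSum_mono _ _ _ _)
  refine tendsto_nhds_unique ((hlim G').const_add _) (((hlim G).const_add _).congr' ?_)
  filter_upwards [Filter.eventually_ge_atTop u.length] with k hk
  exact (hG.add_hitSum _ hG' k n s u hk).symm

/-- The part of the distribution in which `t` is not visited. -/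
theorem SolvesOutside.exists_rest (hG : 𝓜.SolvesOutside t G) (hG' : 𝓜.SolvesOutside t G')
    (n : 𝓜.N) (s : A.State) : ∃ ρ : Measure (Words C),
      (G n s : Measure (Words C)) = 𝓜.hitMeasure t G n s + ρ ∧
      (G' n s : Measure (Words C)) = 𝓜.hitMeasure t G' n s + ρ := by
  have hle := hG.hitMeasure_le _ n s
  have hle' := hG'.hitMeasure_le _ n s
  have hf : IsFiniteMeasure (𝓜.hitMeasure t G n s) := isFiniteMeasure_of_le _ hle
  have hf' : IsFiniteMeasure (𝓜.hitMeasure t G' n s) := isFiniteMeasure_of_le _ hle'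
  have e := Measure.sub_add_cancel_of_le hle
  have e' := Measure.sub_add_cancel_of_le hle'
  refine ⟨G n s - 𝓜.hitMeasure t G n s, by rw [add_comm, e], ?_⟩
  -- The two remainders agree on cylinders by `add_hitMeasure`, hence everywhere.
  have : (G n s : Measure (Words C)) - 𝓜.hitMeasure t G n s =
      (G' n s : Measure (Words C)) - 𝓜.hitMeasure t G' n s := by
    refine measure_ext_wordCyl fun u => ?_
    have h := hG.add_hitMeasure _ hG' n s u
    rw [Measure.sub_apply (measurableSet_wordCyl u) hle,
      Measure.sub_apply (measurableSet_wordCyl u) hle']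
    refine ENNReal.sub_eq_of_eq_add (measure_ne_top _ _) ?_
    rw [ENNReal.sub_add_eq_add_sub (hle' _) (measure_ne_top _ _), ← h,
      ENNReal.add_sub_cancel_right (measure_ne_top _ _)]
  rw [this, add_comm, e']

/-- With common weights and a common remainder, only the components that continue after a path to
`t` have to be compared. -/
theorem SolvesOutside.rel {pref : Preference C} (hG : 𝓜.SolvesOutside t G)
    (hG' : 𝓜.SolvesOutside t G')
    (hmix : MixingUseless pref ∨ ∀ n s x, 𝓜.hitWt t n s x = 0 ∨ 𝓜.hitWt t n s x = 1)
    {n : 𝓜.N} {s : A.State} (w : List C)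
    (h : ∀ x, 𝓜.hitWt t n s x ≠ 0 → pref.rel
      (shiftDist (w ++ A.pathColors s x) (G (𝓜.pathMem n s x) t))
      (shiftDist (w ++ A.pathColors s x) (G' (𝓜.pathMem n s x) t))) :
    pref.rel (shiftDist w (G n s)) (shiftDist w (G' n s)) := by
  classical
  obtain ⟨ρ, e, e'⟩ := hG.exists_rest _ hG' n s
  have hfin : ρ Set.univ ≠ ⊤ := by
    have := congrArg (fun m : Measure (Words C) => m Set.univ) e
    intro h
    simp [h] at this
  obtain ⟨ρ₁, hρ⟩ : ∃ ρ₁ : ProbabilityMeasure (Words C),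
      ρ = ρ Set.univ • (ρ₁ : Measure (Words C)) := by
    by_cases h0 : ρ Set.univ = 0
    -- A null remainder has weight 0, so any probability measure can represent it.
    · refine ⟨G n s, ?_⟩
      rw [h0, zero_smul]
      exact Measure.measure_univ_eq_zero.1 h0
    · refine ⟨⟨(ρ Set.univ)⁻¹ • ρ, ⟨?_⟩⟩, ?_⟩
      · rw [Measure.smul_apply, smul_eq_mul, ENNReal.inv_mul_cancel h0 hfin]
      · rw [ProbabilityMeasure.coe_mk, smul_smul, ENNReal.mul_inv_cancel h0 hfin, one_smul]
  have hsum : ∀ (H : 𝓜.N → A.State → ProbabilityMeasure (Words C)),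
      (H n s : Measure (Words C)) = 𝓜.hitMeasure t H n s + ρ →
      (shiftDist w (H n s) : Measure (Words C)) = Measure.sum
        fun i : Option (List (A.Act × A.State)) =>
          (i.elim (ρ Set.univ) (𝓜.hitWt t n s) : ℝ≥0∞) •
          ((i.elim (shiftDist w ρ₁) fun x => shiftDist w (𝓜.hitLaw t H n s x) :
            ProbabilityMeasure (Words C)) : Measure (Words C)) := by
    intro H hH
    ext E hE
    rw [coe_shiftDist, Measure.map_apply (measurable_prepend _) hE, hH, hρ]
    have hE' := measurable_prepend w hE
    rw [Measure.sum_apply _ hE, ENNReal.tsum_option]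
    simp only [Option.elim, Measure.add_apply, hitMeasure, Measure.sum_apply _ hE',
      Measure.smul_apply, coe_shiftDist, Measure.map_apply (measurable_prepend _) hE, smul_eq_mul]
    rw [add_comm]
    have h1 := ρ₁.2.measure_univ
    have h2 : (ρ₁ : Measure (Words C)) Set.univ = 1 := h1
    simp [h2]
  refine pref.rel_of_sum_eq (hmix.imp_right fun h x => h n s x) (hsum G e) (hsum G' e') ?_
  rintro (_ | x) hx
  · exact pref.refl _
  · simp only [Option.elim, hitLaw, ← shiftDist_append]
    exact h x hx

end Arena.Machine

theorem PMF.map_congr_support {α β : Type*} {p : PMF α} {f g : α → β}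
    (h : ∀ x ∈ p.support, f x = g x) : p.map f = p.map g := by
  classical
  ext b
  simp only [PMF.map_apply]
  refine tsum_congr fun x => ?_
  by_cases hx : x ∈ p.support
  · rw [h x hx]
  · rw [(PMF.apply_eq_zero_iff _ _).2 hx, ite_self, ite_self]

namespace Arena

variable {C : Type*}

/-! ### Embeddings and coverings of arenas -/

/-- Embeddings of `A` into `B`; in `B` there may be more actions available. -/
structure Emb (A B : Arena C) where
  onState : A.State → B.State
  onAct : A.Act → B.Act
  injState : Function.Injective onState
  injAct : Function.Injective onAct
  avail : ∀ s, ∀ a ∈ A.avail s, onAct a ∈ B.avail (onState s)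
  col : ∀ s, ∀ a ∈ A.avail s, B.col (onState s) (onAct a) = A.col s a
  trans : ∀ s, ∀ a ∈ A.avail s, B.trans (onState s) (onAct a) = (A.trans s a).map onState

namespace Emb

variable {A B D : Arena C} (e : Emb A B)

/-- The composition of two embeddings. -/
def comp (e' : Emb B D) (e : Emb A B) : Emb A D where
  onState := e'.onState ∘ e.onState
  onAct := e'.onAct ∘ e.onAct
  injState := e'.injState.comp e.injState
  injAct := e'.injAct.comp e.injAct
  avail s a h := e'.avail _ _ (e.avail s a h)
  col s a h := (e'.col _ _ (e.avail s a h)).trans (e.col s a h)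
  trans s a h := by
    rw [← PMF.map_comp, ← e.trans s a h]
    exact e'.trans _ _ (e.avail s a h)

/-- The image of a step. -/
def onStep (p : A.Step) : B.Step := B.step (e.onState p.1) (e.onAct p.2)

theorem isHist {I : Set A.State} {l : List A.Step} {s : A.State} (h : A.IsHist I l s) :
    B.IsHist (e.onState '' I) (l.map e.onStep) (e.onState s) := by
  induction h with
  | nil h => exact .nil ⟨_, h, rfl⟩
  | snoc _ ha hs ih =>
    rw [List.map_append]
    refine ih.snoc_step (e.avail _ _ ha) ?_
    rw [e.trans _ _ ha, PMF.support_map]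
    exact ⟨_, hs, rfl⟩

open Classical in
/-- The transfer of a machine along an embedding. -/
def up (𝓜 : A.Machine) : B.Machine where
  N := 𝓜.N
  upd n p := if h : ∃ q, e.onStep q = p then 𝓜.upd n h.choose else n
  nxt x n := if h : ∃ s, e.onState s = x then (𝓜.nxt h.choose n).map e.onAct
    else PMF.pure (B.someAct x)

theorem injStep : Function.Injective e.onStep := by
  intro p q h
  obtain ⟨h1, h2⟩ := eq_step_iff.1 h
  exact Prod.ext (e.injState h1) (e.injAct h2)

theorem up_upd_onStep (𝓜 : A.Machine) (n : 𝓜.N) (p : A.Step) :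
    (e.up 𝓜).upd n (e.onStep p) = 𝓜.upd n p := by
  have h : ∃ q, e.onStep q = e.onStep p := ⟨p, rfl⟩
  dsimp only [up]
  rw [dif_pos h, e.injStep h.choose_spec]

theorem up_upd_of_notMem (𝓜 : A.Machine) (n : 𝓜.N) (p : B.Step)
    (h : ∀ s, e.onState s ≠ p.1) : (e.up 𝓜).upd n p = n := by
  dsimp only [up]
  refine dif_neg ?_
  rintro ⟨q, rfl⟩
  exact h q.1 rfl

theorem up_nxt_onState (𝓜 : A.Machine) (n : 𝓜.N) (s : A.State) :
    (e.up 𝓜).nxt (e.onState s) n = (𝓜.nxt s n).map e.onAct := by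
  have h : ∃ q, e.onState q = e.onState s := ⟨s, rfl⟩
  dsimp only [up]
  rw [dif_pos h, e.injState h.choose_spec]

theorem up_ok {X : StratType} {𝓜 : A.Machine} (h : 𝓜.Ok X) : (e.up 𝓜).Ok X where
  avail x n := by
    by_cases hx : ∃ s, e.onState s = x
    · obtain ⟨s, rfl⟩ := hx
      have hn := e.up_nxt_onState 𝓜 n s
      rw [hn, PMF.support_map]
      rintro _ ⟨a, ha, rfl⟩
      exact e.avail _ _ (h.avail s n ha)
    · have hn : (e.up 𝓜).nxt x n = PMF.pure (B.someAct x) := dif_neg hx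
      rw [hn]
      exact support_pure_someAct x
  pure hX x n := by
    by_cases hx : ∃ s, e.onState s = x
    · obtain ⟨s, rfl⟩ := hx
      obtain ⟨a, ha⟩ := h.pure hX s n
      exact ⟨e.onAct a, (e.up_nxt_onState 𝓜 n s).trans (by rw [ha, PMF.pure_map])⟩
    · exact ⟨_, dif_neg hx⟩
  fin hX := h.fin hX

theorem law_up {X : StratType} {𝓜 : A.Machine} (h : 𝓜.Ok X) (n : 𝓜.N) (s : A.State) :
    (e.up 𝓜).law n (e.onState s) = 𝓜.law n s := by
  symm
  -- `law_eq_of_related` asks for a map on actions in the direction opposite to the embedding; a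
  -- left inverse does.
  let φ : B.Act → A.Act := Function.extend e.onAct id fun _ => A.someAct s
  have hφ : ∀ a, φ (e.onAct a) = a := fun a => e.injAct.extend_apply id _ a
  refine Machine.law_eq_of_related (e.up 𝓜) 𝓜
    (fun n s n' s' => n = n' ∧ s' = e.onState s) ?_ ⟨rfl, rfl⟩
  rintro n s _ _ ⟨rfl, rfl⟩
  have hn := e.up_nxt_onState 𝓜 n s
  refine ⟨φ, ?_, fun x hx => ?_⟩
  · rw [hn, PMF.map_comp]
    rw [show φ ∘ e.onAct = id from funext hφ, PMF.map_id]
  · rw [hn, PMF.support_map] at hx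
    obtain ⟨a, ha, rfl⟩ := hx
    have ha' := h.avail s n ha
    rw [hφ]
    refine ⟨(e.col s a ha').symm, e.onState, e.trans s a ha', fun r _ => ⟨?_, rfl⟩⟩
    exact (e.up_upd_onStep 𝓜 n (A.step s a)).symm

theorem cols_subset (X : StratType) (s : A.State) : A.cols X s ⊆ B.cols X (e.onState s) := by
  intro μ hμ
  obtain ⟨𝓜, n, hok, rfl⟩ := mem_cols_iff.1 hμ
  rw [← e.law_up hok n s]
  exact (e.up_ok hok).law_mem_cols _ _

open Classical in
/-- A machine that stays in the image of an embedding induces a distribution of the embedded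
arena. -/
theorem law_mem_cols {X : StratType} {𝓑 : B.Machine} (h : 𝓑.Ok X) (P : 𝓑.N → A.State → Prop)
    (hP : ∀ n s, P n s → ∃ a ∈ A.avail s, 𝓑.nxt (e.onState s) n = PMF.pure (e.onAct a) ∧
      ∀ r ∈ (A.trans s a).support, P (𝓑.upd n (B.step (e.onState s) (e.onAct a))) r)
    {n : 𝓑.N} {s : A.State} (hn : P n s) : 𝓑.law n (e.onState s) ∈ A.cols X s := by
  -- `𝓐` copies the choice of `𝓑` whenever it comes from an action of `A`; under `P` it always does.
  let q : A.State → 𝓑.N → A.Act → Prop := fun s n a =>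
    a ∈ A.avail s ∧ 𝓑.nxt (e.onState s) n = PMF.pure (e.onAct a)
  let ch : A.State → 𝓑.N → A.Act := fun s n =>
    if h : ∃ a, q s n a then h.choose else A.someAct s
  let 𝓐 : A.Machine := ⟨𝓑.N, fun n p => 𝓑.upd n (e.onStep p), fun s n => PMF.pure (ch s n)⟩
  have hok : 𝓐.Ok X := by
    refine ⟨fun s n => ?_, fun _ s n => ⟨_, rfl⟩, fun hX => h.fin hX⟩
    have : ch s n ∈ A.avail s := by
      dsimp only [ch]
      split_ifs with h
      · exact h.choose_spec.1
      · exact someAct_mem s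
    simpa [𝓐] using this
  have hch : ∀ s n a, q s n a → ch s n = a := by
    intro s n a ha
    have hex : ∃ a, q s n a := ⟨a, ha⟩
    have h1 := hex.choose_spec.2
    rw [ha.2] at h1
    have h2 : ch s n = hex.choose := dif_pos hex
    rw [h2]
    have h3 := congrArg PMF.support h1
    rw [PMF.support_pure, PMF.support_pure, Set.singleton_eq_singleton_iff] at h3
    exact (e.injAct h3).symm
  have : 𝓑.law n (e.onState s) = 𝓐.law n s := by
    symm
    let ψ : B.Act → A.Act := Function.extend e.onAct id fun _ => A.someAct s
    have hψ : ∀ a, ψ (e.onAct a) = a := fun a => e.injAct.extend_apply id _ a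
    refine Machine.law_eq_of_related 𝓑 𝓐
      (fun n s n' s' => n = n' ∧ s' = e.onState s ∧ P n' s) ?_ ⟨rfl, rfl, hn⟩
    rintro n s _ _ ⟨rfl, rfl, hn⟩
    obtain ⟨a, ha, hp, hr⟩ := hP n s hn
    refine ⟨ψ, ?_, fun x hx => ?_⟩
    · rw [hp, PMF.pure_map, hψ]
      exact congrArg PMF.pure (hch s n a ⟨ha, hp⟩)
    · rw [hp, PMF.support_pure, Set.mem_singleton_iff] at hx
      subst hx
      rw [hψ]
      exact ⟨(e.col s a ha).symm, e.onState, e.trans s a ha, fun r hrs => ⟨rfl, rfl, hr r hrs⟩⟩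
  rw [this]
  exact hok.law_mem_cols _ _

end Emb

/-- Coverings of `S` by `T`: the transitions of `S` lift to `T`. -/
structure Cover (T S : Arena C) where
  onState : T.State → S.State
  onAct : T.Act → S.Act
  lift : T.State → S.Act → T.Act
  lift_mem : ∀ s, ∀ x ∈ S.avail (onState s), lift s x ∈ T.avail s
  onAct_lift : ∀ s, ∀ x ∈ S.avail (onState s), onAct (lift s x) = x
  col : ∀ s, ∀ x ∈ S.avail (onState s), T.col s (lift s x) = S.col (onState s) x
  trans : ∀ s, ∀ x ∈ S.avail (onState s),
    (T.trans s (lift s x)).map onState = S.trans (onState s) x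

namespace Cover

variable {T S : Arena C} (c : Cover T S)

/-- The transfer of a machine along a covering. -/
def pull (𝓜 : S.Machine) : T.Machine where
  N := 𝓜.N
  upd n p := 𝓜.upd n (S.step (c.onState p.1) (c.onAct p.2))
  nxt s n := (𝓜.nxt (c.onState s) n).map (c.lift s)

theorem pull_ok {X : StratType} {𝓜 : S.Machine} (h : 𝓜.Ok X) : (c.pull 𝓜).Ok X where
  avail s n := by
    change ((𝓜.nxt _ n).map _).support ⊆ _
    rw [PMF.support_map]
    rintro _ ⟨a, ha, rfl⟩
    exact c.lift_mem _ _ (h.avail _ n ha)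
  pure hX s n := by
    obtain ⟨a, ha⟩ := h.pure hX (c.onState s) n
    exact ⟨c.lift s a, (congrArg (PMF.map (c.lift s)) ha).trans (PMF.pure_map _ _)⟩
  fin hX := h.fin hX

theorem law_pull {X : StratType} {𝓜 : S.Machine} (h : 𝓜.Ok X) (n : 𝓜.N) (s : T.State) :
    (c.pull 𝓜).law n s = 𝓜.law n (c.onState s) := by
  refine Machine.law_eq_of_related 𝓜 (c.pull 𝓜)
    (fun n s n' s' => n = n' ∧ s' = c.onState s) ?_ ⟨rfl, rfl⟩
  rintro n s _ _ ⟨rfl, rfl⟩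
  refine ⟨c.lift s, rfl, fun x hx => ?_⟩
  have hx' := h.avail _ _ hx
  refine ⟨c.col s x hx', c.onState, (c.trans s x hx').symm, fun r _ => ⟨?_, rfl⟩⟩
  exact congrArg (fun a => 𝓜.upd n (S.step (c.onState s) a)) (c.onAct_lift s x hx')

/-- Only this inclusion holds in general: the cover may have actions that are no lifts. -/
theorem cols_subset (X : StratType) (s : T.State) : S.cols X (c.onState s) ⊆ T.cols X s := by
  intro μ hμ
  obtain ⟨𝓜, n, hok, rfl⟩ := mem_cols_iff.1 hμ
  rw [← c.law_pull hok n s]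
  exact (c.pull_ok hok).law_mem_cols _ _

end Cover

/-! ### Restricting the available actions -/

/-- The arena with fewer actions available. -/
def restrict (A : Arena C) (av : A.State → Set A.Act) (hav : ∀ s, (av s).Nonempty) : Arena C :=
  { A with avail := av, avail_nonempty := hav }

theorem mem_restrict {Y : ArenaType} {A : Arena C} (hA : Y.Mem A) {av : A.State → Set A.Act}
    (hav : ∀ s, (av s).Nonempty) (h : ∀ s, av s ⊆ A.avail s) : Y.Mem (A.restrict av hav) := by
  refine ⟨fun s hs => ?_, ?_⟩
  · obtain ⟨a, ha⟩ := hA.1 s hs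
    exact ⟨a, (Set.Nonempty.subset_singleton_iff (hav s)).1 (ha ▸ h s)⟩
  · cases Y with
    | det => exact fun s a ha => hA.2 s a (h s ha)
    | stoch => trivial

/-- A machine, viewed in a restriction of the arena. -/
def Machine.restrict {A : Arena C} (𝓜 : A.Machine) (av : A.State → Set A.Act)
    (hav : ∀ s, (av s).Nonempty) : (A.restrict av hav).Machine :=
  ⟨𝓜.N, 𝓜.upd, 𝓜.nxt⟩

/-! ### The reachable part -/

open Classical in
/-- A retraction to the states that are reachable from `t`. -/
def toReach (A : Arena C) (t r : A.State) : {s // ∃ l, A.IsHist {t} l s} :=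
  if h : ∃ l, A.IsHist {t} l r then ⟨r, h⟩ else ⟨t, [], .nil rfl⟩

theorem val_toReach {A : Arena C} {t r : A.State} (h : ∃ l, A.IsHist {t} l r) :
    (A.toReach t r).1 = r := by
  rw [toReach, dif_pos h]

/-- The part of the arena that is reachable from `t`. -/
def reach (A : Arena C) (t : A.State) : Arena C where
  State := {s // ∃ l, A.IsHist {t} l s}
  Act := A.Act
  finState := inferInstance
  finAct := inferInstance
  owner s := A.owner s
  avail s := A.avail s
  avail_nonempty s := A.avail_nonempty s
  trans s a := (A.trans s a).map (A.toReach t)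
  col s a := A.col s a

/-- The root of the reachable part. -/
def reachRoot (A : Arena C) (t : A.State) : (A.reach t).State := ⟨t, [], .nil rfl⟩

/-- The default value of `toReach` is never used, since successors of reachable states are
reachable. -/
theorem map_val_reach (A : Arena C) (t : A.State) (s : (A.reach t).State) (a : A.Act)
    (ha : a ∈ A.avail s.1) :
    ((A.reach t).trans s a).map Subtype.val = A.trans s.1 a := by
  obtain ⟨s, l, hl⟩ := s
  dsimp only [reach]
  refine (PMF.map_comp _ _ _).trans ((PMF.map_congr_support fun q hq => ?_).trans (PMF.map_id _))
  exact val_toReach ⟨_, hl.snoc ha hq⟩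

/-- The embedding of the reachable part. -/
def reachEmb (A : Arena C) (t : A.State) : Emb (A.reach t) A where
  onState := Subtype.val
  onAct := id
  injState := Subtype.val_injective
  injAct := Function.injective_id
  avail _ _ ha := ha
  col _ _ _ := rfl
  trans s a ha := (map_val_reach A t s a ha).symm

theorem mem_support_of_map_eq {α β : Type*} {p : PMF α} {q : PMF β} {g : α → β}
    (hg : Function.Injective g) (h : q = p.map g) {x : α} (hx : g x ∈ q.support) :
    x ∈ p.support := by
  rw [h, PMF.support_map] at hx
  obtain ⟨y, hy, hyx⟩ := hx
  exact hg hyx ▸ hy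

theorem exists_support_map {α β : Type*} {p : PMF α} {g : α → β} (hp : ∃ a, p.support = {a}) :
    ∃ b, (p.map g).support = {b} := by
  obtain ⟨a, ha⟩ := hp
  exact ⟨g a, by rw [PMF.support_map, ha, Set.image_singleton]⟩

theorem mem_reach {Y : ArenaType} {A : Arena C} (hA : Y.Mem A) (t : A.State) :
    Y.Mem (A.reach t) := by
  refine ⟨fun s hs => hA.1 s.1 hs, ?_⟩
  cases Y with
  | det => exact fun s a ha => exists_support_map (hA.2 s.1 a ha)
  | stoch => trivial

theorem isInit_reach (A : Arena C) (t : A.State) : (A.reach t).IsInit {A.reachRoot t} := by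
  refine ⟨⟨_, rfl⟩, ?_⟩
  rintro ⟨s, l, hl⟩
  have key : ∀ l s (hl : A.IsHist {t} l s), ∃ l', (A.reach t).IsHist {A.reachRoot t} l' ⟨s, l, hl⟩ := by
    intro l s hl
    induction hl with
    | nil h =>
      obtain rfl := h
      exact ⟨[], .nil rfl⟩
    | snoc hl ha hs ih =>
      obtain ⟨l', hl'⟩ := ih
      refine ⟨_, hl'.snoc ha ?_⟩
      refine mem_support_of_map_eq (A.reachEmb t).injState
        ((A.reachEmb t).trans ⟨_, _, hl⟩ _ ha) ?_
      exact hs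
  exact key l s hl

end Arena

namespace Arena

variable {C : Type*}

/-! ### Splitting a state -/

theorem onState_redirect {S T : Type} {D : Type} (s₀ : S) (emb : {s // s ≠ s₀} → T) (h : Option T → D)
    (g : S → D) (h0 : h none = g s₀) (h1 : ∀ s, h (some (emb s)) = g s) (s : S) :
    h (redirect s₀ emb s) = g s := by
  unfold redirect
  split_ifs with hs
  · rw [h0, hs]
  · rw [h1]

section Split

open Classical in
/-- The injection that is chosen by membership in `P`. -/
def splitLift {α β : Type} (P : Set α) (i₁ i₂ : α → β) (x : α) : β :=
  if x ∈ P then i₁ x else i₂ x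

theorem splitLift_cases {α β : Type} (P : Set α) (i₁ i₂ : α → β) (x : α) :
    (x ∈ P ∧ splitLift P i₁ i₂ x = i₁ x) ∨ (x ∉ P ∧ splitLift P i₁ i₂ x = i₂ x) := by
  by_cases h : x ∈ P
  · exact .inl ⟨h, if_pos h⟩
  · exact .inr ⟨h, if_neg h⟩

variable (A : Arena C) (t : A.State) (av₁ av₂ : A.State → Set A.Act)
  (hav₁ : ∀ s, (av₁ s).Nonempty) (hav₂ : ∀ s, (av₂ s).Nonempty)

/-- The merge of two restrictions. -/
def splitArena : Arena C :=
  ((A.restrict av₁ hav₁).reach t).merge ((A.restrict av₂ hav₂).reach t)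
      ((A.restrict av₁ hav₁).reachRoot t) ((A.restrict av₂ hav₂).reachRoot t)

/-- The projection of the states of the merge. -/
def splitState : (A.splitArena t av₁ av₂ hav₁ hav₂).State → A.State
  | none => t
  | some (.inl s) => s.1.1
  | some (.inr s) => s.1.1

theorem map_splitState_left (s : ((A.restrict av₁ hav₁).reach t).State) (x : A.Act)
    (hx : x ∈ av₁ s.1) :
    PMF.map (A.splitState t av₁ av₂ hav₁ hav₂) ((((A.restrict av₁ hav₁).reach t).trans s x).map
      (redirect ((A.restrict av₁ hav₁).reachRoot t) .inl)) = A.trans s.1 x := by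
  refine (PMF.map_comp _ _ _).trans ((PMF.map_congr_support fun q _ => ?_).trans
    (map_val_reach (A.restrict av₁ hav₁) t s x hx))
  exact onState_redirect _ Sum.inl (A.splitState t av₁ av₂ hav₁ hav₂) (fun s => s.1) rfl
    (fun _ => rfl) q

theorem map_splitState_right (s : ((A.restrict av₂ hav₂).reach t).State) (x : A.Act)
    (hx : x ∈ av₂ s.1) :
    PMF.map (A.splitState t av₁ av₂ hav₁ hav₂) ((((A.restrict av₂ hav₂).reach t).trans s x).map
      (redirect ((A.restrict av₂ hav₂).reachRoot t) .inr)) = A.trans s.1 x := by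
  refine (PMF.map_comp _ _ _).trans ((PMF.map_congr_support fun q _ => ?_).trans
    (map_val_reach (A.restrict av₂ hav₂) t s x hx))
  exact onState_redirect _ Sum.inr (A.splitState t av₁ av₂ hav₁ hav₂) (fun s => s.1) rfl
    (fun _ => rfl) q

/-- The choice of actions in the merge. -/
def splitAct : (A.splitArena t av₁ av₂ hav₁ hav₂).State → A.Act →
    (A.splitArena t av₁ av₂ hav₁ hav₂).Act
  | none => splitLift (av₁ t) Sum.inl Sum.inr
  | some (.inl _) => Sum.inl
  | some (.inr _) => Sum.inr

theorem splitAct_none (x : A.Act) :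
    (x ∈ av₁ t ∧ A.splitAct t av₁ av₂ hav₁ hav₂ none x = Sum.inl x) ∨
      (x ∉ av₁ t ∧ A.splitAct t av₁ av₂ hav₁ hav₂ none x = Sum.inr x) :=
  splitLift_cases (β := A.Act ⊕ A.Act) _ _ _ _

/-- The merge of two restrictions that share the actions of `t` covers the arena. -/
def splitCover (h₁ : ∀ s, s ≠ t → A.avail s ⊆ av₁ s) (h₂ : ∀ s, s ≠ t → A.avail s ⊆ av₂ s)
    (h : ∀ a ∈ A.avail t, a ∉ av₁ t → a ∈ av₂ t) :
    Cover (A.splitArena t av₁ av₂ hav₁ hav₂) A where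
  onState := A.splitState t av₁ av₂ hav₁ hav₂
  onAct := Sum.elim id id
  -- At each visit to the merged state, the action chosen there decides the copy in which the play
  -- continues until the next visit.
  lift := A.splitAct t av₁ av₂ hav₁ hav₂
  lift_mem := by
    rintro (_ | s | s) x hx
    · rcases A.splitAct_none t av₁ av₂ hav₁ hav₂ x with ⟨hx₁, e⟩ | ⟨hx₁, e⟩ <;> rw [e]
      · exact .inl ⟨x, hx₁, rfl⟩
      · exact .inr ⟨x, h x hx hx₁, rfl⟩
    · exact ⟨x, h₁ _ (fun hs => s.2 (Subtype.ext hs)) hx, rfl⟩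
    · exact ⟨x, h₂ _ (fun hs => s.2 (Subtype.ext hs)) hx, rfl⟩
  onAct_lift := by
    rintro (_ | s | s) x hx
    · rcases A.splitAct_none t av₁ av₂ hav₁ hav₂ x with ⟨hx₁, e⟩ | ⟨hx₁, e⟩ <;> rw [e] <;> rfl
    · rfl
    · rfl
  col := by
    rintro (_ | s | s) x hx
    · rcases A.splitAct_none t av₁ av₂ hav₁ hav₂ x with ⟨hx₁, e⟩ | ⟨hx₁, e⟩ <;> rw [e] <;> rfl
    · rfl
    · rfl
  trans := by
    rintro (_ | s | s) x hx
    · rcases A.splitAct_none t av₁ av₂ hav₁ hav₂ x with ⟨hx₁, e⟩ | ⟨hx₁, e⟩ <;> rw [e]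
      · exact A.map_splitState_left t av₁ av₂ hav₁ hav₂ ((A.restrict av₁ hav₁).reachRoot t) x hx₁
      · exact A.map_splitState_right t av₁ av₂ hav₁ hav₂ ((A.restrict av₂ hav₂).reachRoot t) x
          (h x hx hx₁)
    · exact A.map_splitState_left t av₁ av₂ hav₁ hav₂ s.1 x
        (h₁ _ (fun hs => s.2 (Subtype.ext hs)) hx)
    · exact A.map_splitState_right t av₁ av₂ hav₁ hav₂ s.1 x
        (h₂ _ (fun hs => s.2 (Subtype.ext hs)) hx)

end Split

/-! ### Memoryless machines and switching -/

namespace Machine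

variable {A : Arena C}

/-- The machine that plays `f s` in `s`. -/
def memoryless (A : Arena C) (f : A.State → A.Act) : A.Machine where
  N := Unit
  upd n _ := n
  nxt s _ := PMF.pure (f s)

theorem memoryless_ok {X : StratType} {f : A.State → A.Act} (hf : ∀ s, f s ∈ A.avail s) :
    (memoryless A f).Ok X where
  avail s _ := by simpa [memoryless] using hf s
  pure _ s _ := ⟨f s, rfl⟩
  fin _ := inferInstanceAs (Finite Unit)

open Classical in
/-- The machine that switches to the memoryless machine of `f` when `t` is visited. -/
def switch (𝓜 : A.Machine) (t : A.State) (f : A.State → A.Act) : A.Machine where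
  N := Option 𝓜.N
  upd n p := if p.1 = t then none else n.map fun n => 𝓜.upd n p
  nxt s n := if s = t then PMF.pure (f t) else n.elim (PMF.pure (f s)) (𝓜.nxt s)

/-- Actions are removed at `t` only, and there the switched machine plays `f t`. -/
theorem switch_ok {X : StratType} {𝓜 : A.Machine} (h : 𝓜.Ok X) {t : A.State}
    {f : A.State → A.Act} {av : A.State → Set A.Act} (hav : ∀ s, (av s).Nonempty)
    (heq : ∀ s, s ≠ t → A.avail s ⊆ av s) (hf : ∀ s, f s ∈ av s) :
    ((𝓜.switch t f).restrict av hav).Ok X where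
  avail s n := by
    change ((𝓜.switch t f).nxt s n).support ⊆ av s
    dsimp only [switch]
    split_ifs with hs
    · simpa [hs] using hf t
    · cases n with
      | none => simpa using hf s
      | some n => exact (h.avail s n).trans (heq s hs)
  pure hX s n := by
    change ∃ a, (𝓜.switch t f).nxt s n = PMF.pure a
    dsimp only [switch]
    split_ifs with hs
    · exact ⟨_, rfl⟩
    · cases n with
      | none => exact ⟨_, rfl⟩
      | some n => exact h.pure hX s n
  fin hX := by
    have := h.fin hX
    exact inferInstanceAs (Finite (Option 𝓜.N))

/-- Leaving `t` sets the memory to `none`, which is never left; from then on only `f` is played. -/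
theorem law_switch {𝓜 : A.Machine} {t : A.State} {f : A.State → A.Act} (n : Option 𝓜.N)
    (s : A.State) (h : n = none ∨ s = t) :
    (𝓜.switch t f).law n s = (memoryless A f).law () s := by
  refine Machine.law_eq_of_related (memoryless A f) (𝓜.switch t f)
    (fun n s _ s' => s = s' ∧ (n = none ∨ s = t)) ?_ ⟨rfl, h⟩
  rintro n s _ _ ⟨rfl, h⟩
  refine ⟨id, ?_, fun x hx => ⟨rfl, id, (PMF.map_id _).symm, fun r _ => ⟨rfl, .inl ?_⟩⟩⟩
  · rw [PMF.map_id]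
    by_cases hs : s = t
    · subst hs
      exact if_pos rfl
    · refine (if_neg hs).trans ?_
      rw [h.resolve_right hs]
      rfl
  · by_cases hs : s = t
    · exact if_pos hs
    · refine (if_neg hs).trans ?_
      rw [h.resolve_right hs]
      rfl

theorem solvesOutside_law (𝓜 : A.Machine) (t : A.State) : 𝓜.SolvesOutside t 𝓜.law :=
  fun n s _ _ hE => law_apply 𝓜 n s hE

/-- Before `t` the switched machine imitates `𝓜`. Indexed by the memory of `𝓜`, its laws thus solve
the same equations and can be compared by `SolvesOutside.rel`. -/
theorem solvesOutside_switch (𝓜 : A.Machine) (t : A.State) (f : A.State → A.Act) :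
    𝓜.SolvesOutside t fun n s => (𝓜.switch t f).law (some n) s := by
  intro n s hs E hE
  refine (law_apply (𝓜.switch t f) (some n) s hE).trans ?_
  have h1 : (𝓜.switch t f).nxt s (some n) = 𝓜.nxt s n := if_neg hs
  have h2 : ∀ a, (𝓜.switch t f).upd (some n) (A.step s a) = some (𝓜.upd n (A.step s a)) :=
    fun a => if_neg hs
  rw [h1]
  refine tsum_congr fun a => ?_
  rw [h2]

theorem hitWt_eq_zero_or_one {X : StratType} {𝓜 : A.Machine} (h : 𝓜.Ok X) (hX : X.IsPure)
    (hA : A.Deterministic) (t : A.State) (n : 𝓜.N) (s : A.State) (x : List (A.Act × A.State)) :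
    𝓜.hitWt t n s x = 0 ∨ 𝓜.hitWt t n s x = 1 := by
  classical
  induction x generalizing n s with
  | nil =>
    unfold hitWt
    split_ifs <;> simp
  | cons p x ih =>
    unfold hitWt
    split_ifs
    · exact .inl rfl
    · obtain ⟨a, ha⟩ := h.pure hX s n
      have hav := h.avail s n
      rw [ha, PMF.support_pure, Set.singleton_subset_iff] at hav
      by_cases hp : p.1 = a
      · obtain ⟨r, hr⟩ := hA s a hav
        rw [PMF.support_eq_singleton_iff] at hr
        rw [ha, hp, hr, PMF.pure_apply, PMF.pure_apply, if_pos rfl, one_mul]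
        split_ifs
        · rw [one_mul]
          exact ih _ _
        · simp
      · simp [ha, hp]

end Machine

/-! ### Labellings of the states by memory states -/

/-- A labelling of the states by memory states that is compatible with the updates. -/
def Labels (A : Arena C) (M : MemorySkeleton C) (φ : A.State → M.Mem) : Prop :=
  ∀ s, ∀ a ∈ A.avail s, ∀ r ∈ (A.trans s a).support, φ r = M.upd (φ s) (A.col s a)

theorem colors_append (A : Arena C) (l l' : List A.Step) :
    A.colors (l ++ l') = A.colors l ++ A.colors l' := List.map_append

/-- Applied to cycles at `t`, this is the cycle condition that selectivity demands. -/
theorem Labels.run_colors {A : Arena C} {M : MemorySkeleton C} {φ : A.State → M.Mem}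
    (h : A.Labels M φ) {t : A.State} {l : List A.Step} {s : A.State} (hl : A.IsHist {t} l s) :
    M.run (φ t) (A.colors l) = φ s := by
  induction hl with
  | nil ht => rw [ht]; rfl
  | snoc _ ha hs ih =>
    rw [colors_append, M.run_append, ih, h _ _ ha _ hs]
    rfl

theorem Labels.run_pathColors {A : Arena C} {M : MemorySkeleton C} {φ : A.State → M.Mem}
    (h : A.Labels M φ) {X : StratType} {𝓜 : A.Machine} (hok : 𝓜.Ok X) {t : A.State} {n : 𝓜.N}
    {s : A.State} {x : List (A.Act × A.State)} (hx : 𝓜.hitWt t n s x ≠ 0) :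
    M.run (φ s) (A.pathColors s x) = φ t := by
  classical
  induction x generalizing n s with
  | nil =>
    unfold Machine.hitWt at hx
    split_ifs at hx with hs
    · rw [hs]; rfl
    · exact (hx rfl).elim
  | cons p x ih =>
    unfold Machine.hitWt at hx
    split_ifs at hx with hs
    · exact (hx rfl).elim
    · have h1 := left_ne_zero_of_mul hx
      have h2 := left_ne_zero_of_mul (right_ne_zero_of_mul hx)
      have h3 := right_ne_zero_of_mul (right_ne_zero_of_mul hx)
      rw [← ih h3, h s p.1 (hok.avail s n h1) p.2 h2]
      rfl

theorem Labels.reach {A : Arena C} {M : MemorySkeleton C} {φ : A.State → M.Mem}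
    (h : A.Labels M φ) (t : A.State) : (A.reach t).Labels M fun s => φ s.1 := by
  intro s a ha r hr
  refine h s.1 a ha r.1 ?_
  have := (A.reachEmb t).trans s a ha
  rw [show A.trans s.1 a = _ from this, PMF.support_map]
  exact ⟨r, hr, rfl⟩

end Arena

open Arena Machine

/-! ### From monotony and selectivity to memoryless strategies -/

section Sufficiency

variable {C : Type*} {M : MemorySkeleton C} {pref : Preference C} {X : StratType} {Y : ArenaType}

/-- The memoryless machine of `f` is at least as good as all the machines of type `X`, from the
state `s`, after all the words that lead to the memory state `m`. -/
def DominatesFrom (M : MemorySkeleton C) (pref : Preference C) (X : StratType) (A : Arena C)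
    (m : M.Mem) (s : A.State) (f : A.State → A.Act) : Prop :=
  ∀ w ∈ M.lang M.init m, ∀ 𝓜 : A.Machine, 𝓜.Ok X → ∀ n,
    pref.rel (shiftDist w (𝓜.law n s)) (shiftDist w ((memoryless A f).law () s))

/-- The machine is first improved by switching to `f` at `t`; the result is a machine of the
restricted arena, where `f` is already known to dominate. -/
theorem dominatesFrom_of_restrict {A : Arena C} {φ : A.State → M.Mem}
    (hφ : A.Labels M φ) (hmix : (X.IsPure ∧ A.Deterministic) ∨ MixingUseless pref)
    {av : A.State → Set A.Act} (hav : ∀ s, (av s).Nonempty)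
    {t : A.State} (heq : ∀ s, s ≠ t → A.avail s ⊆ av s) {f : A.State → A.Act}
    (hf : ∀ s, f s ∈ av s)
    (hdom : ∀ s, DominatesFrom M pref X (A.restrict av hav) (φ s) s f)
    (ht : DominatesFrom M pref X A (φ t) t f) (s : A.State) :
    DominatesFrom M pref X A (φ s) s f := by
  intro w hw 𝓜 hok n
  refine pref.trans _ (shiftDist w ((𝓜.switch t f).law (some n) s)) _ ?_ ?_
  · refine (𝓜.solvesOutside_law t).rel 𝓜 (𝓜.solvesOutside_switch t f) ?_ w fun x hx => ?_
    · exact hmix.symm.imp_right fun h n s x => hitWt_eq_zero_or_one hok h.1 h.2 t n s x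
    · rw [law_switch (some _) t (.inr rfl)]
      -- After `w` and the path, the skeleton is in the label of `t`, so domination at `t` applies
      -- to the lengthened word.
      refine ht _ ?_ 𝓜 hok _
      change M.run M.init _ = _
      rw [M.run_append, show M.run M.init w = φ s from hw, hφ.run_pathColors hok hx]
  -- Laws ignore the sets of available actions, so reading the machine in the restriction leaves its
  -- law unchanged by definition.
  · exact hdom s w hw _ (switch_ok hok hav heq hf) (some n)

theorem dominatesFrom_reach {A : Arena C} {av : A.State → Set A.Act}
    {hav : ∀ s, (av s).Nonempty} {m : M.Mem} {t : A.State} {f : A.State → A.Act}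
    (h : DominatesFrom M pref X (A.restrict av hav) m t f) {w : List C}
    (hw : w ∈ M.lang M.init m) {μ : ProbabilityMeasure (Words C)}
    (hμ : μ ∈ ((A.restrict av hav).reach t).cols X ((A.restrict av hav).reachRoot t)) :
    pref.rel (shiftDist w μ) (shiftDist w ((memoryless A f).law () t)) := by
  obtain ⟨𝓜, n, hok, rfl⟩ := mem_cols_iff.1
    (((A.restrict av hav).reachEmb t).cols_subset X _ hμ)
  exact h w hw 𝓜 hok n

/-- The induction needs domination from all states and after all words to the label, since paths to
`t` lengthen the word. Each half of the actions of `t` gives an arena with fewer available pairs. -/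
theorem exists_memoryless_dominating (hmono : IsMonotone X Y M pref)
    (hsel : IsSelective X Y M pref)
    (hmix : (X.IsPure ∧ Y = ArenaType.det) ∨ MixingUseless pref) (N : ℕ) (A : Arena C)
    (hA : Y.Mem A) (φ : A.State → M.Mem) (hφ : A.Labels M φ)
    (hN : {p : A.Step | p.2 ∈ A.avail p.1}.ncard < N) :
    ∃ f : A.State → A.Act, (∀ s, f s ∈ A.avail s) ∧ ∀ s, DominatesFrom M pref X A (φ s) s f := by
  classical
  induction N generalizing A with
  | zero => exact (Nat.not_lt_zero _ hN).elim
  | succ N ih =>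
  by_cases huniq : ∀ s, ∃ a, A.avail s = {a}
  -- Without any choice, all machines have the same law.
  · choose f hf using huniq
    refine ⟨f, fun s => by rw [hf]; rfl, fun s w _ 𝓜 hok n => ?_⟩
    rw [show 𝓜.law n s = (memoryless A f).law () s from ?_]
    · exact pref.refl _
    · refine law_eq_of_related (memoryless A f) 𝓜 (fun n s _ s' => s = s') ?_ rfl
      rintro n s _ _ rfl
      refine ⟨id, ?_, fun x _ => ⟨rfl, id, (PMF.map_id _).symm, fun _ _ => rfl⟩⟩
      rw [PMF.map_id]
      refine PMF.support_eq_singleton_iff.1 ((Set.Nonempty.subset_singleton_iff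
        (PMF.support_nonempty _)).1 ?_)
      rw [← hf]
      exact hok.avail s n
  · push Not at huniq
    obtain ⟨t, ht⟩ := huniq
    have hmix' : (X.IsPure ∧ A.Deterministic) ∨ MixingUseless pref := by
      refine hmix.imp_left fun h => ⟨h.1, ?_⟩
      obtain ⟨-, rfl⟩ := h
      exact hA.2
    -- One half keeps a single action of `t`, the other all the rest; both are nonempty since `t`
    -- has at least two.
    let av : Bool → A.State → Set A.Act := fun b s => if s = t then
      (if b then {A.someAct t} else A.avail t \ {A.someAct t}) else A.avail s
    have hav : ∀ b s, (av b s).Nonempty := by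
      intro b s
      dsimp only [av]
      split_ifs
      · exact ⟨_, rfl⟩
      · rw [Set.nonempty_iff_ne_empty, Ne, Set.sdiff_eq_empty]
        exact fun h => ht _ ((Set.Nonempty.subset_singleton_iff (A.avail_nonempty t)).1 h)
      · exact A.avail_nonempty s
    have hsub : ∀ b s, av b s ⊆ A.avail s := by
      intro b s
      dsimp only [av]
      split_ifs with hs
      · rw [hs, Set.singleton_subset_iff]; exact A.someAct_mem t
      · rw [hs]; exact Set.sdiff_subset
      · exact subset_rfl
    have heq : ∀ b s, s ≠ t → A.avail s ⊆ av b s := fun b s hs => by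
      dsimp only [av]; rw [if_neg hs]
    have hlab : ∀ b, (A.restrict (av b) (hav b)).Labels M φ :=
      fun b s a ha r hr => hφ s a (hsub b s ha) r hr
    have hstrict : ∀ b, ∃ a ∈ A.avail t, a ∉ av b t := by
      intro b
      obtain ⟨a, ha⟩ := hav (!b) t
      refine ⟨a, hsub _ _ ha, fun h => ?_⟩
      cases b <;> simp [av] at ha h
      · exact h.2 ha
      · exact ha.2 h
    have hIH : ∀ b, ∃ f : A.State → A.Act, (∀ s, f s ∈ av b s) ∧
        ∀ s, DominatesFrom M pref X (A.restrict (av b) (hav b)) (φ s) s f := by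
      intro b
      refine ih (A.restrict (av b) (hav b)) (mem_restrict hA _ (hsub b)) φ (hlab b) ?_
      obtain ⟨a, ha, ha'⟩ := hstrict b
      refine lt_of_lt_of_le (Set.ncard_lt_ncard ?_ (Set.toFinite _)) (Nat.lt_succ_iff.1 hN)
      refine Set.ssubset_iff_of_subset (fun p hp => hsub b p.1 hp) |>.2 ⟨A.step t a, ha, ha'⟩
    choose f hf hdom using hIH
    have hB : ∀ b, Y.Mem ((A.restrict (av b) (hav b)).reach t) :=
      fun b => mem_reach (mem_restrict hA _ (hsub b)) t
    have hinit : ∀ b, ((A.restrict (av b) (hav b)).reach t).IsInit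
        {(A.restrict (av b) (hav b)).reachRoot t} := 
      fun b => isInit_reach (A.restrict (av b) (hav b)) t
    have hcyc : ∀ b l, ((A.restrict (av b) (hav b)).reach t).IsHist
        {(A.restrict (av b) (hav b)).reachRoot t} l ((A.restrict (av b) (hav b)).reachRoot t) →
        ((A.restrict (av b) (hav b)).reach t).colors l ∈ M.lang (φ t) (φ t) :=
      fun b l hl => ((hlab b).reach t).run_colors hl
    have hsplit : A.cols X t ⊆
        (A.splitArena t (av true) (av false) (hav true) (hav false)).cols X none :=
      (splitCover A t (av true) (av false) (hav true) (hav false) (heq true) (heq false) (by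
        intro a ha h
        simp only [av, if_true] at h ⊢
        exact ⟨ha, h⟩)).cols_subset X none
    have key : ∀ b, (∀ w ∈ M.lang M.init (φ t), pref.setRel
        (shiftDist w '' ((A.restrict (av (!b)) (hav (!b))).reach t).cols X
          ((A.restrict (av (!b)) (hav (!b))).reachRoot t))
        (shiftDist w '' ((A.restrict (av b) (hav b)).reach t).cols X
          ((A.restrict (av b) (hav b)).reachRoot t))) →
        ∃ f : A.State → A.Act, (∀ s, f s ∈ A.avail s) ∧
          ∀ s, DominatesFrom M pref X A (φ s) s f := by
      intro b hb
      refine ⟨f b, fun s => hsub b s (hf b s), dominatesFrom_of_restrict hφ hmix' (hav b) (heq b)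
        (hf b) (hdom b) fun w hw 𝓜 hok n => ?_⟩
      have hmem : 𝓜.law n t ∈ (A.splitArena t (av true) (av false) (hav true) (hav false)).cols X
          none := hsplit (hok.law_mem_cols n t)
      -- The half provided by selectivity may vary with the word and the machine; `hb` then moves
      -- the comparison to the fixed half `b`.
      obtain ⟨μ, hμ, hrel⟩ := hsel (φ t) _ _ _ _ (hB true) (hinit true) (hB false) (hinit false)
        (hcyc true) (hcyc false) w hw _ ⟨_, hmem, rfl⟩
      have hμ' : ∃ b', μ ∈ shiftDist w '' ((A.restrict (av b') (hav b')).reach t).cols X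
          ((A.restrict (av b') (hav b')).reachRoot t) :=
        hμ.elim (fun h => ⟨true, h⟩) fun h => ⟨false, h⟩
      obtain ⟨b', hμ'⟩ := hμ'
      refine pref.trans _ _ _ hrel ?_
      obtain rfl | rfl : b' = b ∨ b' = !b := by cases b <;> cases b' <;> simp
      · obtain ⟨ν, hν, rfl⟩ := hμ'
        exact dominatesFrom_reach (hdom b' t) hw hν
      · obtain ⟨_, ⟨ν, hν, rfl⟩, hrel'⟩ := hb w hw _ hμ'
        exact pref.trans _ _ _ hrel' (dominatesFrom_reach (hdom b t) hw hν)
    rcases hmono (φ t) _ _ _ _ (hB true) (hinit true) (hB false) (hinit false) with h | h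
    · exact key false h
    · exact key true h

end Sufficiency

namespace Arena

variable {C : Type*}

/-! ### Products with finite memory -/

/-- The product of an arena with a finite memory. -/
def prodMem (A : Arena C) (k : ℕ) (upd : Fin k → A.Step → Fin k) : Arena C where
  State := A.State × Fin k
  Act := A.Act
  finState := inferInstance
  finAct := inferInstance
  owner s := A.owner s.1
  avail s := A.avail s.1
  avail_nonempty s := A.avail_nonempty s.1
  trans s a := (A.trans s.1 a).map fun r => (r, upd s.2 (A.step s.1 a))
  col s a := A.col s.1 a

/-- The projection of the product. -/
def prodMemCover (A : Arena C) (k : ℕ) (upd : Fin k → A.Step → Fin k) :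
    Cover (A.prodMem k upd) A where
  onState := Prod.fst
  onAct := id
  lift _ x := x
  lift_mem _ _ hx := hx
  onAct_lift _ _ _ := rfl
  col _ _ _ := rfl
  trans _ _ _ := (PMF.map_comp _ _ _).trans (PMF.map_id _)

theorem mem_prodMem {Y : ArenaType} {A : Arena C} (hA : Y.Mem A) (k : ℕ)
    (upd : Fin k → A.Step → Fin k) : Y.Mem (A.prodMem k upd) := by
  refine ⟨fun s hs => hA.1 s.1 hs, ?_⟩
  cases Y with
  | det => exact fun s a ha => exists_support_map (hA.2 s.1 a ha)
  | stoch => trivial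

/-- The machine that plays a memoryless strategy of the product. -/
def Machine.ofProdMem (A : Arena C) (k : ℕ) (upd : Fin k → A.Step → Fin k)
    (f : A.State × Fin k → A.Act) : A.Machine where
  N := Fin k
  upd := upd
  nxt s j := PMF.pure (f (s, j))

theorem Machine.law_ofProdMem (A : Arena C) (k : ℕ) (upd : Fin k → A.Step → Fin k)
    (f : A.State × Fin k → A.Act) (j : Fin k) (s : A.State) :
    (Machine.ofProdMem A k upd f).law j s =
      (Machine.memoryless (A.prodMem k upd) f).law () (s, j) := by
  symm
  refine Machine.law_eq_of_related (Machine.ofProdMem A k upd f)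
    (Machine.memoryless (A.prodMem k upd) f) (fun _ s j s' => s = (s', j)) ?_ rfl
  rintro _ _ j s' rfl
  refine ⟨id, (PMF.map_id _).symm, fun x _ => ⟨rfl, Prod.fst, ?_, ?_⟩⟩
  · exact ((PMF.map_comp (fun r => (r, upd j (A.step s' x))) (A.trans s' x) Prod.fst).trans
      (PMF.map_id _)).symm
  · intro r hr
    obtain ⟨q, -, rfl⟩ := (PMF.mem_support_map_iff _ _ _).1 hr
    rfl

end Arena

theorem MemorySkeleton.val_foldl {C : Type*} {M : MemorySkeleton C} {A : Arena C} {N : Type*}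
    {val : N → M.Mem} {upd : N → A.Step → N}
    (hupd : ∀ j p, val (upd j p) = M.upd (val j) (A.col p.1 p.2)) (l : List A.Step) (j : N) :
    val (l.foldl upd j) = M.run (val j) (A.colors l) := by
  induction l generalizing j with
  | nil => rfl
  | cons p l ih =>
    rw [List.foldl_cons, ih, hupd]
    rfl

/-- The product is labelled by its memory component, and a memoryless choice there is a machine with
memory `Fin k` on `A`. -/
theorem exists_ofProdMem_dominating {C : Type*} {M : MemorySkeleton C}
    {pref : Preference C} {X : StratType} {Y : ArenaType}
    (hmix : (X.IsPure ∧ Y = ArenaType.det) ∨ MixingUseless pref)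
    (hmono : IsMonotone X Y M pref) (hsel : IsSelective X Y M pref) {A : Arena C} (hA : Y.Mem A)
    {k : ℕ} {val : Fin k → M.Mem} {upd : Fin k → A.Step → Fin k}
    (hupd : ∀ j p, val (upd j p) = M.upd (val j) (A.col p.1 p.2)) :
    ∃ f : A.State × Fin k → A.Act, (Machine.ofProdMem A k upd f).Ok X ∧
      ∀ s j, ∀ w ∈ M.lang M.init (val j), ∀ μ ∈ A.cols X s,
        pref.rel (shiftDist w μ) (shiftDist w ((Machine.ofProdMem A k upd f).law j s)) := by
  obtain ⟨f, hf, hdom⟩ := exists_memoryless_dominating hmono hsel hmix _ (A.prodMem k upd)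
    (mem_prodMem hA k upd) (fun s => val s.2) (by
      intro s a _ r hr
      obtain ⟨q, -, rfl⟩ := (PMF.mem_support_map_iff _ _ _).1 hr
      exact hupd s.2 (A.step s.1 a)) (Nat.lt_succ_self _)
  refine ⟨f, ⟨fun s j => ?_, fun _ s j => ⟨_, rfl⟩, fun _ => inferInstanceAs (Finite (Fin k))⟩,
    fun s j w hw μ hμ => ?_⟩
  · refine (PMF.support_pure _).le.trans (Set.singleton_subset_iff.2 ?_)
    exact hf (s, j)
  · have hμ' : μ ∈ (A.prodMem k upd).cols X (s, j) :=
      (A.prodMemCover k upd).cols_subset X (s, j) hμ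
    obtain ⟨𝓜, n, h𝓜, rfl⟩ := mem_cols_iff.1 hμ'
    have e := Machine.law_ofProdMem A k upd f j s
    rw [e]
    exact hdom (s, j) w hw 𝓜 h𝓜 n

theorem pureSuffice_of_isMonotone_of_isSelective {C : Type*} {M : MemorySkeleton C}
    {pref : Preference C} {X : StratType} {Y : ArenaType}
    (hmix : (X.IsPure ∧ Y = ArenaType.det) ∨ MixingUseless pref)
    (hmono : IsMonotone X Y M pref) (hsel : IsSelective X Y M pref) : PureSuffice M pref X Y := by
  classical
  intro A I hA _
  obtain ⟨k, val, j₀, upd, hval, hj₀, hupd⟩ := M.exists_finite_memory A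
  obtain ⟨f, hok, hdom⟩ := exists_ofProdMem_dominating hmix hmono hsel hA hupd
  have hf : ∀ s j, f (s, j) ∈ A.avail s := by
    intro s j
    have := hok.avail s j
    exact this ((PMF.mem_support_pure_iff _ _).2 rfl)
  refine ⟨(Machine.ofProdMem A k upd f).strat j₀, ?_, ?_, ?_⟩
  · intro l s _ _
    exact ⟨f (s, l.foldl upd j₀), PMF.support_pure _⟩
  -- Memory states outside the range of `val` never occur in this arena; a default action serves
  -- there.
  · refine ⟨fun s m => if h : ∃ j, val j = m then PMF.pure (f (s, h.choose)) else
      PMF.pure (A.someAct s), fun s m _ => ?_, fun l s _ _ => ?_⟩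
    · dsimp only
      split_ifs with h
      · rw [PMF.support_pure, Set.singleton_subset_iff]
        exact hf s h.choose
      · exact support_pure_someAct s
    · have e := MemorySkeleton.val_foldl hupd l j₀
      rw [hj₀] at e
      have h : ∃ j, val j = M.run M.init (A.colors l) := ⟨_, e⟩
      dsimp only
      rw [dif_pos h, hval (h.choose_spec.trans e.symm)]
      rfl
  · refine hok.isOptimal hA.1 fun s _ μ hμ => ?_
    -- Optimality is domination after the empty word, which leads to the initial memory state.
    have := hdom s j₀ [] hj₀.symm μ hμ
    rwa [shiftDist_nil, shiftDist_nil] at this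

namespace Arena

variable {C : Type*}

theorem IsHist.append {A : Arena C} {I : Set A.State} {l l' : List A.Step} {t s : A.State}
    (h : A.IsHist I l t) (h' : A.IsHist {t} l' s) : A.IsHist I (l ++ l') s := by
  induction h' with
  | nil ht =>
    rw [List.append_nil, show _ = t from ht]
    exact h
  | snoc _ ha hs ih =>
    rw [← List.append_assoc]
    exact ih.snoc ha hs

/-! ### Words in front of an arena -/

section Fork

variable (A : Arena C) (t : A.State) (w : Bool → List C)

/-- The states of a fork. -/
abbrev ForkState : Type := (Σ b : Bool, Fin (w b).length) ⊕ A.State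

variable {w} in
/-- The state that is reached after the first `i` letters of a word. -/
def forkEntry (b : Bool) (i : ℕ) : A.ForkState w :=
  if h : i < (w b).length then .inl ⟨b, i, h⟩ else .inr t

/-- Two words that lead to the state `t` of an arena. -/
def fork : Arena C where
  State := A.ForkState w
  Act := A.Act
  finState := inferInstance
  finAct := inferInstance
  owner
    | .inl _ => .one
    | .inr s => A.owner s
  avail
    | .inl _ => {A.someAct t}
    | .inr s => A.avail s
  avail_nonempty
    | .inl _ => ⟨_, rfl⟩
    | .inr s => A.avail_nonempty s
  trans
    | .inl i => fun _ => PMF.pure (A.forkEntry t i.1 (i.2 + 1))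
    | .inr s => fun a => (A.trans s a).map .inr
  col
    | .inl i => fun _ => (w i.1)[i.2]
    | .inr s => A.col s

/-- The first state of a word. -/
def forkInit (b : Bool) : (A.fork t w).State := A.forkEntry t b 0

/-- The embedding of the arena in the fork. -/
def forkEmb : Emb A (A.fork t w) where
  onState := Sum.inr
  onAct := id
  injState := Sum.inr_injective
  injAct := Function.injective_id
  avail _ _ h := h
  col _ _ _ := rfl
  trans _ _ _ := rfl

theorem forkEntry_length (b : Bool) : A.forkEntry (w := w) t b (w b).length = .inr t :=
  dif_neg (lt_irrefl _)

variable {A t w}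

theorem mem_fork {Y : ArenaType} (hA : Y.Mem A) : Y.Mem (A.fork t w) := by
  refine ⟨?_, ?_⟩
  · rintro (i | s) hs
    · cases hs
    · exact hA.1 s hs
  · cases Y with
    | det =>
      rintro (i | s) a ha
      · exact ⟨_, PMF.support_pure _⟩
      · exact exists_support_map (hA.2 s a ha)
    | stoch => trivial

theorem isInit_fork (hA : A.IsInit {t}) :
    (A.fork t w).IsInit (Set.range (A.forkInit t w)) := by
  have hchain : ∀ b i, i ≤ (w b).length →
      ∃ l, (A.fork t w).IsHist (Set.range (A.forkInit t w)) l (A.forkEntry t b i) := by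
    intro b i
    induction i with
    | zero => exact fun _ => ⟨[], .nil ⟨b, rfl⟩⟩
    | succ i ih =>
      intro hi
      obtain ⟨l, hl⟩ := ih (Nat.le_of_succ_le hi)
      rw [show A.forkEntry (w := w) t b i = .inl ⟨b, i, hi⟩ from dif_pos hi] at hl
      exact ⟨_, IsHist.snoc (A := A.fork t w) (a := A.someAct t) hl rfl
        ((PMF.mem_support_pure_iff _ _).2 rfl)⟩
  refine ⟨Set.range_nonempty _, ?_⟩
  rintro (⟨b, i⟩ | s)
  · have := hchain b i i.2.le
    rwa [show A.forkEntry (w := w) t b i = .inl ⟨b, i⟩ from dif_pos i.2] at this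
  · obtain ⟨l, hl⟩ := hchain true _ le_rfl
    rw [forkEntry_length] at hl
    obtain ⟨l', hl'⟩ := hA.2 s
    have := (A.forkEmb t w).isHist hl'
    rw [Set.image_singleton] at this
    exact ⟨_, hl.append this⟩

theorem Machine.law_of_pure (𝓜 : A.Machine) {n : 𝓜.N} {s r : A.State} {a : A.Act}
    (ha : 𝓜.nxt s n = PMF.pure a) (hr : A.trans s a = PMF.pure r) :
    𝓜.law n s = shiftDist [A.col s a] (𝓜.law (𝓜.upd n (A.step s a)) r) := by
  classical
  refine probabilityMeasure_ext_wordCyl fun u => ?_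
  have hu := measurableSet_wordCyl u
  rw [Machine.law_apply _ _ _ hu, coe_shiftDist, Measure.map_apply (measurable_prepend _) hu, ha,
    tsum_eq_single a, hr, tsum_eq_single r]
  · simp
  · intro q hq
    simp [hq]
  · intro q hq
    simp [hq]

/-- A machine reads the words in front of the arena; `Q` is an invariant of its memory. -/
theorem Machine.Ok.exists_law_forkInit {X : StratType} {𝓑 : (A.fork t w).Machine} (h : 𝓑.Ok X)
    (b : Bool) (Q : ℕ → 𝓑.N → Prop)
    (hQ : ∀ (i : ℕ) (hi : i < (w b).length) n, Q i n →
      Q (i + 1) (𝓑.upd n ((A.fork t w).step (.inl ⟨b, i, hi⟩) (A.someAct t))))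
    {n : 𝓑.N} (hn : Q 0 n) :
    ∃ n', Q (w b).length n' ∧
      𝓑.law n (A.forkInit t w b) = shiftDist (w b) (𝓑.law n' ((A.forkEmb t w).onState t)) := by
  -- Induction on the number `j` of letters still to be read.
  have key : ∀ j i, i + j = (w b).length → ∀ n, Q i n → ∃ n', Q (w b).length n' ∧
      𝓑.law n (A.forkEntry t b i : A.ForkState w) =
        shiftDist ((w b).drop i) (𝓑.law n' ((A.forkEmb t w).onState t)) := by
    intro j
    induction j with
    | zero =>
      rintro i hi n hn
      obtain rfl : i = (w b).length := hi
      refine ⟨n, hn, ?_⟩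
      rw [List.drop_length, shiftDist_nil, forkEntry_length]
      rfl
    | succ j ih =>
      intro i hi n hn
      have hi' : i < (w b).length := by omega
      obtain ⟨n', hn', e⟩ := ih (i + 1) (by omega) _ (hQ i hi' n hn)
      refine ⟨n', hn', ?_⟩
      have hnxt : 𝓑.nxt (.inl ⟨b, i, hi'⟩ : A.ForkState w) n = PMF.pure (A.someAct t) :=
        PMF.support_eq_singleton_iff.1 ((Set.Nonempty.subset_singleton_iff
          (PMF.support_nonempty _)).1 (h.avail (.inl ⟨b, i, hi'⟩ : A.ForkState w) n))
      have e' := 𝓑.law_of_pure hnxt rfl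
      rw [e] at e'
      rw [show A.forkEntry (w := w) t b i = .inl ⟨b, i, hi'⟩ from dif_pos hi', e',
        ← shiftDist_append]
      congr 1
      exact List.getElem_cons_drop hi'
  exact key (w b).length 0 (by simp) n hn

theorem shiftDist_mem_cols_fork {X : StratType} (b : Bool) {μ : ProbabilityMeasure (Words C)}
    (hμ : μ ∈ A.cols X t) : shiftDist (w b) μ ∈ (A.fork t w).cols X (A.forkInit t w b) := by
  obtain ⟨𝓜, n, hok, rfl⟩ := mem_cols_iff.1 hμ
  have hok' := (A.forkEmb t w).up_ok hok
  obtain ⟨n', hn', e⟩ := hok'.exists_law_forkInit b (fun _ n' => n' = n)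
    -- The transferred machine ignores steps outside the embedded arena, so it enters `t` with its
    -- starting memory.
    (fun i hi n' hn' =>
      ((A.forkEmb t w).up_upd_of_notMem 𝓜 n' _ (fun s hs => by cases hs)).trans hn') rfl
  rw [hn', (A.forkEmb t w).law_up hok] at e
  rw [← e]
  exact hok'.law_mem_cols _ _

end Fork

/-! ### The embeddings of two arenas in their merge -/

section Merge

theorem redirect_self {S T : Type} (s₀ : S) (emb : {s // s ≠ s₀} → T) :
    redirect s₀ emb s₀ = none := dif_pos rfl

theorem redirect_of_ne {S T : Type} {s₀ : S} (emb : {s // s ≠ s₀} → T) {s : S} (h : s ≠ s₀) :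
    redirect s₀ emb s = some (emb ⟨s, h⟩) := dif_neg h

theorem redirect_injective {S T : Type} {s₀ : S} {emb : {s // s ≠ s₀} → T}
    (h : Function.Injective emb) : Function.Injective (redirect s₀ emb) := by
  intro s s' e
  by_cases hs : s = s₀ <;> by_cases hs' : s' = s₀
  · rw [hs, hs']
  · rw [hs, redirect_self, redirect_of_ne _ hs'] at e
    cases e
  · rw [hs', redirect_self, redirect_of_ne _ hs] at e
    cases e
  · rw [redirect_of_ne _ hs, redirect_of_ne _ hs'] at e
    exact congrArg Subtype.val (h (Option.some_injective _ e))

variable {A₁ A₂ : Arena C} {s₁ : A₁.State} {s₂ : A₂.State}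

variable (A₁ A₂ s₁ s₂) in
/-- The embedding of the first arena in the merge. -/
def mergeLeft : Emb A₁ (A₁.merge A₂ s₁ s₂) where
  onState := redirect s₁ .inl
  onAct := .inl
  injState := redirect_injective Sum.inl_injective
  injAct := Sum.inl_injective
  avail s a ha := by
    by_cases hs : s = s₁
    · subst hs; rw [redirect_self]; exact .inl ⟨a, ha, rfl⟩
    · rw [redirect_of_ne _ hs]; exact ⟨a, ha, rfl⟩
  col s a _ := by
    by_cases hs : s = s₁
    · subst hs; rw [redirect_self]; rfl
    · rw [redirect_of_ne _ hs]; rfl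
  trans s a _ := by
    by_cases hs : s = s₁
    · subst hs; rw [redirect_self]; rfl
    · rw [redirect_of_ne _ hs]; rfl

variable (A₁ A₂ s₁ s₂) in
/-- The embedding of the second arena in the merge. -/
def mergeRight : Emb A₂ (A₁.merge A₂ s₁ s₂) where
  onState := redirect s₂ .inr
  onAct := .inr
  injState := redirect_injective Sum.inr_injective
  injAct := Sum.inr_injective
  avail s a ha := by
    by_cases hs : s = s₂
    · subst hs; rw [redirect_self]; exact .inr ⟨a, ha, rfl⟩
    · rw [redirect_of_ne _ hs]; exact ⟨a, ha, rfl⟩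
  col s a _ := by
    by_cases hs : s = s₂
    · subst hs; rw [redirect_self]; rfl
    · rw [redirect_of_ne _ hs]; rfl
  trans s a _ := by
    by_cases hs : s = s₂
    · subst hs; rw [redirect_self]; rfl
    · rw [redirect_of_ne _ hs]; rfl

theorem mergeLeft_avail {s : A₁.State} (hs : s ≠ s₁) :
    (A₁.merge A₂ s₁ s₂).avail ((mergeLeft A₁ A₂ s₁ s₂).onState s) ⊆
      (mergeLeft A₁ A₂ s₁ s₂).onAct '' A₁.avail s := by
  rw [show (mergeLeft A₁ A₂ s₁ s₂).onState s = some (.inl ⟨s, hs⟩) from redirect_of_ne _ hs]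
  exact subset_rfl

theorem mergeRight_avail {s : A₂.State} (hs : s ≠ s₂) :
    (A₁.merge A₂ s₁ s₂).avail ((mergeRight A₁ A₂ s₁ s₂).onState s) ⊆
      (mergeRight A₁ A₂ s₁ s₂).onAct '' A₂.avail s := by
  rw [show (mergeRight A₁ A₂ s₁ s₂).onState s = some (.inr ⟨s, hs⟩) from redirect_of_ne _ hs]
  exact subset_rfl

theorem mergeLeft_root : (mergeLeft A₁ A₂ s₁ s₂).onState s₁ = A₁.mergeState A₂ s₁ s₂ :=
  redirect_self _ _

theorem mergeRight_root : (mergeRight A₁ A₂ s₁ s₂).onState s₂ = A₁.mergeState A₂ s₁ s₂ :=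
  redirect_self _ _

theorem mem_merge {Y : ArenaType} (h₁ : Y.Mem A₁) (h₂ : Y.Mem A₂) :
    Y.Mem (A₁.merge A₂ s₁ s₂) := by
  refine ⟨?_, ?_⟩
  · rintro (_ | s | s) hs
    · cases hs
    · obtain ⟨a, ha⟩ := h₁.1 s.1 hs
      exact ⟨.inl a, (congrArg (Sum.inl '' ·) ha).trans Set.image_singleton⟩
    · obtain ⟨a, ha⟩ := h₂.1 s.1 hs
      exact ⟨.inr a, (congrArg (Sum.inr '' ·) ha).trans Set.image_singleton⟩
  · cases Y with
    | det =>
      rintro (_ | s | s) a ha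
      · obtain ⟨a, ha, rfl⟩ | ⟨a, ha, rfl⟩ := ha
        · exact exists_support_map (h₁.2 _ a ha)
        · exact exists_support_map (h₂.2 _ a ha)
      · obtain ⟨a, ha, rfl⟩ := ha
        exact exists_support_map (h₁.2 _ a ha)
      · obtain ⟨a, ha, rfl⟩ := ha
        exact exists_support_map (h₂.2 _ a ha)
    | stoch => trivial

theorem isInit_merge (h₁ : A₁.IsInit {s₁}) (h₂ : A₂.IsInit {s₂}) :
    (A₁.merge A₂ s₁ s₂).IsInit {A₁.mergeState A₂ s₁ s₂} := by
  refine ⟨⟨_, rfl⟩, ?_⟩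
  rintro (_ | s | s)
  · exact ⟨[], .nil rfl⟩
  · obtain ⟨l, hl⟩ := h₁.2 s.1
    have := (mergeLeft A₁ A₂ s₁ s₂).isHist hl
    rw [Set.image_singleton, mergeLeft_root] at this
    rw [show (mergeLeft A₁ A₂ s₁ s₂).onState s.1 = some (.inl s) from redirect_of_ne _ s.2] at this
    exact ⟨_, this⟩
  · obtain ⟨l, hl⟩ := h₂.2 s.1
    have := (mergeRight A₁ A₂ s₁ s₂).isHist hl
    rw [Set.image_singleton, mergeRight_root] at this
    rw [show (mergeRight A₁ A₂ s₁ s₂).onState s.1 = some (.inr s) from redirect_of_ne _ s.2] at this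
    exact ⟨_, this⟩

end Merge

end Arena

/-! ### Optimal strategies based on a skeleton in a merge -/

namespace Arena

variable {C : Type*}

theorem Machine.Ok.of_pureFM {A : Arena C} {𝓜 : A.Machine} (h : 𝓜.Ok .pureFM) (X : StratType) :
    𝓜.Ok X :=
  ⟨h.avail, fun _ => h.pure (.inl rfl), fun _ => h.fin (.inl rfl)⟩

/-- An optimal strategy that is based on a memory skeleton, as a finite machine. -/
theorem _root_.PureSuffice.exists_machine {M : MemorySkeleton C} {pref : Preference C}
    {X : StratType} {Y : ArenaType} (h : PureSuffice M pref X Y) {A : Arena C} (hA : Y.Mem A)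
    {I : Set A.State} (hI : A.IsInit I) :
    ∃ (𝓑 : A.Machine) (val : 𝓑.N → M.Mem) (n₀ : 𝓑.N), 𝓑.Ok .pureFM ∧ Function.Injective val ∧
      val n₀ = M.init ∧ (∀ n p, val (𝓑.upd n p) = M.upd (val n) (A.col p.1 p.2)) ∧
      ∀ s ∈ I, ∀ μ ∈ A.cols X s, pref.rel μ (𝓑.law n₀ s) := by
  obtain ⟨σ, hpure, ⟨nxt, hav, hnxt⟩, hopt⟩ := h A I hA hI
  obtain ⟨k, val, j₀, upd, hval, hj₀, hupd⟩ := M.exists_finite_memory A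
  -- The machine has to move for player 2 as well; any available action is the forced one.
  have hok₂ : ∀ X : StratType, (memoryless A A.someAct).Ok X :=
    fun X => memoryless_ok A.someAct_mem
  have h₂ := (hok₂ X).strat_mem () I .two
  have hj : ∀ l s, A.IsHist I l s →
      A.joint σ ((memoryless A A.someAct).strat ()) l s = (match A.owner s with
        | .one => nxt s (val (l.foldl upd j₀))
        | .two => PMF.pure (A.someAct s)) := by
    intro l s hl
    rw [MemorySkeleton.val_foldl hupd, hj₀]
    unfold joint
    cases ho : A.owner s
    · exact hnxt l s hl ho
    · rfl
  obtain ⟨nxt', hok, hstrat⟩ := exists_ok_of_strat (X := .pureFM) (I := I)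
    (σ := A.joint σ ((memoryless A A.someAct).strat ()))
    (fun l s hl => joint_support hopt.1 h₂ hl) (by
      intro _ l s hl
      unfold joint
      cases ho : A.owner s
      · obtain ⟨a, ha⟩ := hpure l s hl ho
        exact ⟨a, PMF.support_eq_singleton_iff.1 ha⟩
      · exact ⟨_, rfl⟩) (Fin k) (fun _ => inferInstance) j₀ upd
    (fun s j => match A.owner s with
        | .one => nxt s (val j)
        | .two => PMF.pure (A.someAct s)) hj
  refine ⟨_, val, j₀, hok, hval, hj₀, hupd, fun s hs μ hμ => ?_⟩
  have hsI := Set.singleton_subset_iff.2 hs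
  rw [← Machine.colDist_eq_law _ _ s σ ((memoryless A A.someAct).strat ())
    (fun l r hl => joint_support hopt.1 h₂ (hl.mono hsI))
    (fun l r hl => (hstrat l r (hl.mono hsI)).symm)]
  exact hopt.exists_machine hA.1 h₂ hs hμ

/-- If the machine stays in the first choice that it makes at the root, then it induces a
distribution of the chosen arena. -/
theorem Emb.law_mem_cols_of_root {M : MemorySkeleton C} {A B : Arena C} (e : Emb A B)
    (X : StratType) {r : A.State}
    (hav : ∀ s, s ≠ r → B.avail (e.onState s) ⊆ e.onAct '' A.avail s) {m : M.Mem}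
    (hcyc : ∀ l, A.IsHist {r} l r → A.colors l ∈ M.lang m m) {𝓑 : B.Machine}
    (hok : 𝓑.Ok .pureFM) {val : 𝓑.N → M.Mem} (hval : Function.Injective val)
    (hupd : ∀ n p, val (𝓑.upd n p) = M.upd (val n) (B.col p.1 p.2)) {n : 𝓑.N} (hn : val n = m)
    {a : A.Act} (ha : a ∈ A.avail r) (hna : 𝓑.nxt (e.onState r) n = PMF.pure (e.onAct a)) :
    𝓑.law n (e.onState r) ∈ A.cols X r := by
  refine e.law_mem_cols (hok.of_pureFM X)
    (fun n s => ∃ l, A.IsHist {r} l s ∧ val n = M.run m (A.colors l)) ?_ ⟨[], .nil rfl, hn⟩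
  rintro n' s ⟨l, hl, hn'⟩
  have hch : ∃ a ∈ A.avail s, 𝓑.nxt (e.onState s) n' = PMF.pure (e.onAct a) := by
    by_cases hs : s = r
    · subst hs
      -- Back at the root the skeleton is again in `m`, so the machine is in its original memory
      -- state and repeats its choice.
      have : n' = n := hval (by rw [hn', hn]; exact hcyc l hl)
      exact ⟨a, ha, this ▸ hna⟩
    · obtain ⟨x, hx⟩ := hok.pure (.inl rfl) (e.onState s) n'
      have h1 := hok.avail (e.onState s) n'
      rw [hx, PMF.support_pure, Set.singleton_subset_iff] at h1
      obtain ⟨a, ha, rfl⟩ := hav s hs h1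
      exact ⟨a, ha, hx⟩
  obtain ⟨a, ha, hx⟩ := hch
  refine ⟨a, ha, hx, fun q hq => ⟨_, hl.snoc_step ha hq, ?_⟩⟩
  rw [hupd, hn', colors_append, M.run_append, step_fst, step_snd, e.col s a ha]
  rfl

/-- A single strategy has to be optimal from the beginnings of both words and cannot tell them apart
once both have led to `m`; its one choice at the root therefore serves both. -/
theorem _root_.PureSuffice.merge {M : MemorySkeleton C} {pref : Preference C} {X : StratType}
    {Y : ArenaType} (h : PureSuffice M pref X Y) {m : M.Mem} {A₁ A₂ : Arena C} {s₁ : A₁.State}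
    {s₂ : A₂.State} (h₁ : Y.Mem A₁) (hi₁ : A₁.IsInit {s₁}) (h₂ : Y.Mem A₂) (hi₂ : A₂.IsInit {s₂})
    (hc₁ : ∀ l, A₁.IsHist {s₁} l s₁ → A₁.colors l ∈ M.lang m m)
    (hc₂ : ∀ l, A₂.IsHist {s₂} l s₂ → A₂.colors l ∈ M.lang m m)
    {w : Bool → List C} (hw : ∀ b, w b ∈ M.lang M.init m) :
    (∀ b, pref.setRel
        (shiftDist (w b) '' (A₁.merge A₂ s₁ s₂).cols X (A₁.mergeState A₂ s₁ s₂))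
        (shiftDist (w b) '' A₁.cols X s₁)) ∨
      ∀ b, pref.setRel
        (shiftDist (w b) '' (A₁.merge A₂ s₁ s₂).cols X (A₁.mergeState A₂ s₁ s₂))
        (shiftDist (w b) '' A₂.cols X s₂) := by
  set A := A₁.merge A₂ s₁ s₂ with hAdef
  set t : A.State := A₁.mergeState A₂ s₁ s₂ with ht
  have hA : Y.Mem A := mem_merge h₁ h₂
  obtain ⟨𝓑, val, n₀, hok, hval, hn₀, hupd, hopt⟩ :=
    h.exists_machine (A := A.fork t w) (mem_fork hA) (isInit_fork (isInit_merge hi₁ hi₂))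
  have hread : ∀ b, ∃ n, val n = m ∧ 𝓑.law n₀ (A.forkInit t w b) =
      shiftDist (w b) (𝓑.law n ((A.forkEmb t w).onState t)) := by
    intro b
    obtain ⟨n, hn, e⟩ := hok.exists_law_forkInit b
      (fun i n => val n = M.run M.init ((w b).take i)) (fun i hi n hn => by
        rw [hupd, hn, List.take_add_one, List.getElem?_eq_getElem hi, M.run_append]
        rfl) (n := n₀) (by rw [hn₀]; rfl)
    refine ⟨n, ?_, e⟩
    rw [hn, List.take_length]
    exact hw b
  obtain ⟨n, hn, -⟩ := hread true
  have hread' : ∀ b, 𝓑.law n₀ (A.forkInit t w b) =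
      shiftDist (w b) (𝓑.law n ((A.forkEmb t w).onState t)) := by
    intro b
    obtain ⟨n', hn', e⟩ := hread b
    -- Injectivity of `val` identifies the memory states reached after the two words.
    rwa [hval (hn'.trans hn.symm)] at e
  have hfinal : ∀ {D : Arena C} {r : D.State},
      𝓑.law n ((A.forkEmb t w).onState t) ∈ D.cols X r →
      ∀ b, pref.setRel (shiftDist (w b) '' A.cols X t) (shiftDist (w b) '' D.cols X r) := by
    rintro D r hD b _ ⟨μ, hμ, rfl⟩
    refine ⟨_, ⟨_, hD, rfl⟩, ?_⟩
    rw [← hread' b]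
    exact hopt _ ⟨b, rfl⟩ _ (shiftDist_mem_cols_fork b hμ)
  obtain ⟨x, hx⟩ := hok.pure (.inl rfl) ((A.forkEmb t w).onState t) n
  have hxav := hok.avail ((A.forkEmb t w).onState t) n
  rw [hx, PMF.support_pure, Set.singleton_subset_iff] at hxav
  -- The action chosen at the merged state belongs to one of the two arenas and decides the
  -- alternative.
  obtain ⟨a, ha, rfl⟩ | ⟨a, ha, rfl⟩ := hxav
  · left
    refine hfinal ?_
    have hroot : ((A.forkEmb t w).comp (mergeLeft A₁ A₂ s₁ s₂)).onState s₁ =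
      (A.forkEmb t w).onState t := congrArg Sum.inr mergeLeft_root
    have := ((A.forkEmb t w).comp (mergeLeft A₁ A₂ s₁ s₂)).law_mem_cols_of_root X
      (r := s₁) (fun s hs => mergeLeft_avail hs) hc₁ hok hval hupd hn ha (by rw [hroot]; exact hx)
    rwa [hroot] at this
  · right
    refine hfinal ?_
    have hroot : ((A.forkEmb t w).comp (mergeRight A₁ A₂ s₁ s₂)).onState s₂ =
      (A.forkEmb t w).onState t := congrArg Sum.inr mergeRight_root
    have := ((A.forkEmb t w).comp (mergeRight A₁ A₂ s₁ s₂)).law_mem_cols_of_root X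
      (r := s₂) (fun s hs => mergeRight_avail hs) hc₂ hok hval hupd hn ha (by rw [hroot]; exact hx)
    rwa [hroot] at this

/-! ### A fresh root -/

section Fresh

variable (A : Arena C) (s₀ : A.State)

/-- The arena with a fresh copy of `s₀` that is never revisited. -/
def fresh : Arena C where
  State := Option A.State
  Act := A.Act
  finState := inferInstance
  finAct := inferInstance
  owner s := A.owner (s.getD s₀)
  avail s := A.avail (s.getD s₀)
  avail_nonempty s := A.avail_nonempty (s.getD s₀)
  trans s a := (A.trans (s.getD s₀) a).map some
  col s a := A.col (s.getD s₀) a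

/-- The projection that identifies `s₀` with its copy. -/
def freshCover : Cover (A.fresh s₀) A where
  onState s := s.getD s₀
  onAct := id
  lift _ x := x
  lift_mem _ _ hx := hx
  onAct_lift _ _ _ := rfl
  col _ _ _ := rfl
  trans _ _ _ := (PMF.map_comp _ _ _).trans (PMF.map_id _)

/-- The projection onto the arena of its reachable part. -/
def reachCover : Cover (A.reach s₀) A where
  onState := Subtype.val
  onAct := id
  lift _ x := x
  lift_mem _ _ hx := hx
  onAct_lift _ _ _ := rfl
  col _ _ _ := rfl
  trans s x hx := map_val_reach A s₀ s x hx

open Classical in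
/-- The copy of a state to be used, given whether the play is at its beginning. -/
def freshState (b : Bool) (s : A.State) : Option A.State :=
  if b = true ∧ s = s₀ then none else some s

theorem freshState_getD (b : Bool) (s : A.State) : (A.freshState s₀ b s).getD s₀ = s := by
  unfold freshState
  split_ifs with h
  · exact h.2.symm
  · rfl

/-- A machine of the arena with a fresh root, transferred to the arena. -/
def unfresh (𝓜 : (A.fresh s₀).Machine) : A.Machine where
  N := 𝓜.N × Bool
  upd n p := (𝓜.upd n.1 ((A.fresh s₀).step (A.freshState s₀ n.2 p.1) p.2), false)
  nxt s n := 𝓜.nxt (A.freshState s₀ n.2 s) n.1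

variable {A s₀}

theorem unfresh_ok {X : StratType} {𝓜 : (A.fresh s₀).Machine} (h : 𝓜.Ok X) :
    (A.unfresh s₀ 𝓜).Ok X where
  avail s n := by
    have := h.avail (A.freshState s₀ n.2 s) n.1
    change _ ⊆ A.avail (Option.getD _ _) at this
    rwa [freshState_getD] at this
  pure hX s n := h.pure hX (A.freshState s₀ n.2 s) n.1
  fin hX := by
    have := h.fin hX
    exact inferInstanceAs (Finite (𝓜.N × Bool))

theorem law_unfresh (𝓜 : (A.fresh s₀).Machine) (n : 𝓜.N) :
    (A.unfresh s₀ 𝓜).law (n, true) s₀ = 𝓜.law n (none : Option A.State) := by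
  symm
  refine Machine.law_eq_of_related (A.unfresh s₀ 𝓜) 𝓜
    (fun n s n' s' => n = n'.1 ∧ s = A.freshState s₀ n'.2 s') ?_
    (n := n) (n' := (n, true)) ⟨rfl, (if_pos ⟨rfl, rfl⟩).symm⟩
  rintro _ _ ⟨n, b⟩ s ⟨rfl, rfl⟩
  have hD := A.freshState_getD s₀ b s
  refine ⟨id, (PMF.map_id _).symm, fun x _ => ⟨?_, fun r => Option.getD r s₀, ?_, ?_⟩⟩
  · exact congrArg (A.col · x) hD
  · exact (congrArg (A.trans · x) hD).symm.trans ((PMF.map_comp some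
      (A.trans ((A.freshState s₀ b s).getD s₀) x) fun r => Option.getD r s₀).trans
        (PMF.map_id _)).symm
  · intro r hr
    obtain ⟨q, -, rfl⟩ := (PMF.mem_support_map_iff _ _ _).1 hr
    refine ⟨rfl, ?_⟩
    -- After one step the flag is false, so the original `s₀` is meant from then on.
    exact (if_neg fun h => by cases h.1).symm

/-- The root and its copy may be treated differently; one extra bit of memory, telling whether the
play has begun, simulates this in `A` within every type. -/
theorem cols_fresh_subset (X : StratType) :
    (A.fresh s₀).cols X (none : Option A.State) ⊆ A.cols X s₀ := by
  intro μ hμ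
  obtain ⟨𝓜, n, hok, rfl⟩ := mem_cols_iff.1 hμ
  rw [← law_unfresh]
  exact (unfresh_ok hok).law_mem_cols _ _

theorem isHist_fresh_none {l : List (A.fresh s₀).Step} {s : Option A.State}
    (h : (A.fresh s₀).IsHist {(none : Option A.State)} l s) (hs : s = none) : l = [] := by
  cases h with
  | nil _ => rfl
  | snoc _ _ hr =>
    obtain ⟨q, -, e⟩ := (PMF.mem_support_map_iff _ _ _).1 hr
    rw [← e] at hs
    cases hs

theorem mem_fresh {Y : ArenaType} (hA : Y.Mem A) : Y.Mem (A.fresh s₀) := by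
  refine ⟨fun s hs => hA.1 (s.getD s₀) hs, ?_⟩
  cases Y with
  | det => exact fun s a ha => exists_support_map (hA.2 (s.getD s₀) a ha)
  | stoch => trivial

variable (A s₀) in
/-- The reachable part of the arena with a fresh root. -/
def unroll : Arena C := (A.fresh s₀).reach none

variable (A s₀) in
/-- The root of the unrolled arena. -/
def unrollRoot : (A.unroll s₀).State := (A.fresh s₀).reachRoot none

/-- Unrolling keeps the attainable distributions and, by `eq_nil_of_isHist_unrollRoot`, makes the
cycle condition at the root trivial. -/
theorem cols_unroll (X : StratType) : (A.unroll s₀).cols X (A.unrollRoot s₀) = A.cols X s₀ := by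
  apply subset_antisymm
  · exact (((A.fresh s₀).reachEmb none).cols_subset X _).trans (cols_fresh_subset X)
  · exact ((A.freshCover s₀).cols_subset X none).trans
      (((A.fresh s₀).reachCover none).cols_subset X ((A.fresh s₀).reachRoot none))

theorem eq_nil_of_isHist_unrollRoot {l : List (A.unroll s₀).Step}
    (h : (A.unroll s₀).IsHist {A.unrollRoot s₀} l (A.unrollRoot s₀)) : l = [] := by
  have h' := ((A.fresh s₀).reachEmb none).isHist h
  have e : ((A.fresh s₀).reachEmb none).onState '' {A.unrollRoot s₀} =
    {(none : Option A.State)} := Set.image_singleton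
  exact List.map_eq_nil_iff.1 (isHist_fresh_none
    (congrArg (fun I => (A.fresh s₀).IsHist I _ _) e ▸ h') rfl)

end Fresh

end Arena

/-! ### Selectivity and monotony from optimal strategies -/

theorem isSelective_of_pureSuffice {C : Type*} {M : MemorySkeleton C} {pref : Preference C}
    {X : StratType} {Y : ArenaType} (h : PureSuffice M pref X Y) : IsSelective X Y M pref := by
  intro m A₁ A₂ s₁ s₂ h₁ hi₁ h₂ hi₂ hc₁ hc₂ w hw μ hμ
  -- Both words are `w`.
  rcases h.merge h₁ hi₁ h₂ hi₂ hc₁ hc₂ (w := fun _ => w) fun _ => hw with h | h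
  · obtain ⟨ν, hν, hrel⟩ := h true μ hμ
    exact ⟨ν, .inl hν, hrel⟩
  · obtain ⟨ν, hν, hrel⟩ := h true μ hμ
    exact ⟨ν, .inr hν, hrel⟩

/-- If neither arena wins uniformly, each loses after some word. A choice in the merge that is good
after both words would refute one of the two failures. -/
theorem isMonotone_of_pureSuffice {C : Type*} {M : MemorySkeleton C} {pref : Preference C}
    {X : StratType} {Y : ArenaType} (h : PureSuffice M pref X Y) : IsMonotone X Y M pref := by
  intro m A₁ A₂ s₁ s₂ h₁ _ h₂ _
  by_contra! hne
  obtain ⟨⟨w₁, hw₁, hn₁⟩, w₂, hw₂, hn₂⟩ := hne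
  have hcyc : ∀ (A : Arena C) (s : A.State) l,
      (A.unroll s).IsHist {A.unrollRoot s} l (A.unrollRoot s) →
      (A.unroll s).colors l ∈ M.lang m m := by
    intro A s l hl
    rw [eq_nil_of_isHist_unrollRoot hl]
    rfl
  have hsub : ∀ {S S' T : Set (ProbabilityMeasure (Words C))}, S' ⊆ S → pref.setRel S T →
      pref.setRel S' T := fun hS h μ hμ => h μ (hS hμ)
  -- The side that is chosen is tested on the word after which it was supposed to lose: `w₂` for the
  -- first arena, `w₁` for the second.
  rcases h.merge (w := fun b => if b then w₁ else w₂)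
      (mem_reach (mem_fresh (s₀ := s₁) h₁) _) (isInit_reach (A₁.fresh s₁) none)
      (mem_reach (mem_fresh (s₀ := s₂) h₂) _) (isInit_reach (A₂.fresh s₂) none)
      (hcyc A₁ s₁) (hcyc A₂ s₂) (by rintro (_ | _); exacts [hw₂, hw₁]) with h | h
  · refine hn₂ ?_
    rw [← cols_unroll (A := A₁), ← cols_unroll (A := A₂)]
    refine hsub (Set.image_mono ?_) (h false)
    have := (mergeRight (A₁.unroll s₁) (A₂.unroll s₂) (A₁.unrollRoot s₁)
      (A₂.unrollRoot s₂)).cols_subset X (A₂.unrollRoot s₂)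
    rwa [mergeRight_root] at this
  · refine hn₁ ?_
    rw [← cols_unroll (A := A₁), ← cols_unroll (A := A₂)]
    refine hsub (Set.image_mono ?_) (h true)
    have := (mergeLeft (A₁.unroll s₁) (A₂.unroll s₂) (A₁.unrollRoot s₁)
      (A₂.unrollRoot s₂)).cols_subset X (A₁.unrollRoot s₁)
    rwa [mergeLeft_root] at this

end

theorem mainTheorem3 {C : Type*} (M : MemorySkeleton C) (pref : Preference C)
    (X : StratType) (Y : ArenaType) :
    (((X = StratType.pure ∨ X = StratType.pureFM) ∧ Y = ArenaType.det ∨ MixingUseless pref) →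
      (PureSuffice M pref X Y ↔ IsMonotone X Y M pref ∧ IsSelective X Y M pref)) ∧
    (∀ f : Words C → ℝ, Measurable f → ExpectationWellDefined f →
      MixingUseless (payoffPreference f)) := by
  refine ⟨fun hmix => ⟨fun h => ⟨isMonotone_of_pureSuffice h, isSelective_of_pureSuffice h⟩,
    fun h => pureSuffice_of_isMonotone_of_isSelective ?_ h.1 h.2⟩,
    fun f _ hw => mixingUseless_payoffPreference hw⟩
  exact hmix.imp_left fun h => ⟨h.1.symm, h.2⟩
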